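/- For a tuple $\mathbf l=(l_1,\ldots,l_s)$ of nonnegative integers with $l_1+\cdots+l_s=m$ and a prime power $q$, let $M^{\mathbf l}(q)$ be the set of $m\times m$ block upper triangular matrices over $\mathbb F_q$ with diagonal blocks of sizes $l_1,\ldots,l_s$. Let $P^{\mathbf l}(q)$ be the group of invertible matrices in $M^{\mathbf l}(q)$, let $N^{\mathbf l}(q)$ be the set of nilpotent matrices in $M^{\mathbf l}(q)$, and let $\rho_{\mathbf l}(q)$ be the number of orbits of $P^{\mathbf l}(q)$ acting on $N^{\mathbf l}(q)$ by conjugation. Write $(1^m)=(1,\ldots,1)$ ($m$ entries). Theorem. (i) Let $m$ be a positive integer and let $n=m(m-1)/2$. There exist integers $a_0,a_1,\ldots,a_n$, depending only on $m$, such that, for all prime powers $q$, $$\rho_{(1^m)}(q)=\sum_{j=0}^{n}a_j\,\rho_{(j,m)}(q).$$ (ii) Suppose that for any positive integers $k$ and $m$ there is a polynomial $g$ with rational coefficients such that $\rho_{(k,m)}(q)=g(q)$ for all prime powers $q$. Then for every positive integer $m$ there is a polynomial $h$ with rational coefficients such that $\rho_{(1^m)}(q)=h(q)$ for all prime powers $q$.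 -/

import Mathlib

universe u

namespace Parabolic

/-- Row and column labels of block matrices of shape `l = (l₁, …, lₛ)`: the pair `⟨i, x⟩` is the
`x`-th position inside the `i`-th block. -/
abbrev Index {s : ℕ} (l : Fin s → ℕ) : Type := Σ i : Fin s, Fin (l i)

/-- The position of the block that contains a given row or column. -/
def block {s : ℕ} (l : Fin s → ℕ) (x : Index l) : Fin s := x.1

/-- `P^l(K)`: the group of all invertible block upper triangular matrices with diagonal blocks of
sizes `l₁, …, lₛ`. -/
def parabolic {s : ℕ} (l : Fin s → ℕ) (K : Type u) [Field K] : Subgroup (Matrix.GeneralLinearGroup (Index l) K) where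
  carrier := {g | (g : Matrix (Index l) (Index l) K).BlockTriangular (block l)}
  mul_mem' := by
    intro a b ha hb
    exact Matrix.BlockTriangular.mul ha hb
  one_mem' := Matrix.blockTriangular_one
  inv_mem' := by
    intro g hg
    have : Invertible (g : Matrix (Index l) (Index l) K) := g.invertible
    have h := Matrix.blockTriangular_inv_of_blockTriangular (M := g.1) hg
    change Matrix.BlockTriangular ((g⁻¹).1) (block l)
    rwa [Matrix.coe_units_inv]

/-- `N^l(K)`: the set of all nilpotent block upper triangular matrices with diagonal blocks of
sizes `l₁, …, lₛ`. -/
def nilpotents {s : ℕ} (l : Fin s → ℕ) (K : Type u) [Field K] :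
    Set (Matrix (Index l) (Index l) K) :=
  {x | x.BlockTriangular (block l) ∧ IsNilpotent x}

/-- The conjugation action `g • x = g x g⁻¹` of `P^l(K)` on `N^l(K)`. -/
instance conjAction {s : ℕ} (l : Fin s → ℕ) (K : Type u) [Field K] :
    MulAction (parabolic l K) (nilpotents l K) where
  smul g x :=
    ⟨g.1.1 * x.1 * (g⁻¹).1.1,
      (Matrix.BlockTriangular.mul g.2 x.2.1).mul (g⁻¹).2, by
        obtain ⟨n, hn⟩ := x.2.2
        refine ⟨n, ?_⟩
        have h := Units.conj_pow g.1 x.1 n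
        rw [hn, mul_zero, zero_mul] at h
        exact h⟩
  one_smul x := Subtype.ext (by
    change (1 : Matrix (Index l) (Index l) K) * x.1 * ((1 : parabolic l K)⁻¹).1.1 = x.1
    simp)
  mul_smul g h x := Subtype.ext (by
    change (g * h).1.1 * x.1 * ((g * h)⁻¹).1.1 =
      g.1.1 * (h.1.1 * x.1 * (h⁻¹).1.1) * (g⁻¹).1.1
    simp only [mul_inv_rev, Subgroup.coe_mul, Units.val_mul, mul_assoc])

/-- `ρ_l(q)` for a field `K` with `q` elements: the number of `P^l(K)`-orbits on `N^l(K)`. -/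
noncomputable def rho {s : ℕ} (l : Fin s → ℕ) (K : Type u) [Field K] : ℕ :=
  Nat.card (MulAction.orbitRel.Quotient (parabolic l K) (nilpotents l K))

/-- `ρ_l(q)`, as a function of the prime power `q`, is a polynomial in `q` with rational
coefficients. -/
def RhoIsPolynomial {s : ℕ} (l : Fin s → ℕ) : Prop :=
  ∃ g : Polynomial ℚ, ∀ (K : Type u) [Field K] [Finite K],
    (rho l K : ℚ) = g.eval (Nat.card K : ℚ)

/-- For all positive integers `k` and `m`, `ρ_{(k,m)}(q)` is a polynomial in `q` with rational
coefficients. -/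
def MaximalParabolicConjecture : Prop :=
  ∀ k m : ℕ, 0 < k → 0 < m → RhoIsPolynomial.{u} ![k, m]

/-- For every positive integer `m`, `ρ_{(1^m)}(q)` is a polynomial in `q` with rational
coefficients. -/
def UnitriangularConjecture : Prop :=
  ∀ m : ℕ, 0 < m → RhoIsPolynomial.{u} (fun _ : Fin m => 1)

end Parabolic

/-! By Burnside's lemma, `rho l K` times the order of `parabolic l K` is the number of commuting
pairs (g, x) of block triangular matrices with g invertible and x nilpotent. For l = (j, m), sort
these pairs by the pair p' induced on the quotient W = K^m. With V = K^j, trace duality gives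
|Hom(W, V)| times the number of triples (g, T, h) with (g, T) a commuting pair on V and h : (V, g,
T) → (W, p') a homomorphism. Hence |GL_m| `rho ![j, m] K` is the sum over p' of c_j(p') = `homCount`
/ |GL_j| (`rho_two_mul_glCard`). For l = (1^m), double counting pairs and triangularising bases
shows that |GL_m| `rho` is the sum over p' of the number of p'-invariant complete flags. That number
is `adaptedCount` divided by the order of the Borel group. It therefore suffices to write it, for
each p', as one fixed integral combination of c_0(p'), ..., c_n(p').

Let H_W be the generating series of the c_j(p'). Factoring homomorphisms through their images gives
H_W = ∑ X^(dim I) H_I over the invariant subspaces I of W (`homSeries_eq_sum`). The term I = W moves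
to the left as 1 - X^m, and by induction (1 - X)...(1 - X^m) H_W = h P, where h is a polynomial of
degree at most n and P = H_0. At X = 1 only flags with one-dimensional steps survive, so h(1) is the
number of invariant complete flags (`exists_polynomial_homSeries`). Burnside's lemma for a single
block, together with the Jordan form, shows that P counts partitions and so does not depend on K.
Thus h = H_W E with E = (1 - X)...(1 - X^m) / P an integral power series, and summing the
coefficients of H_W E up to degree n gives (i). Part (ii) follows because `rho ![0, m]` is constant
in q. -/

open Module

namespace Parabolic

/-! ### Trace duality between homomorphisms and off-diagonal blocks -/

section TraceDuality

variable {K V W : Type*} [Field K] [AddCommGroup V] [Module K V] [FiniteDimensional K V]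
  [AddCommGroup W] [Module K W] [FiniteDimensional K W]

-- The rank-one maps w ↦ φ(w) v already suffice: composing with h gives trace φ(h v).
omit [FiniteDimensional K V] in
theorem eq_zero_of_trace_comp_eq_zero (h : V →ₗ[K] W)
    (H : ∀ c : W →ₗ[K] V, LinearMap.trace K W (h ∘ₗ c) = 0) : h = 0 := by
  ext v
  rw [LinearMap.zero_apply, ← Module.forall_dual_apply_eq_zero_iff K]
  intro φ
  have := H (φ.smulRight v)
  have e : h ∘ₗ φ.smulRight v = φ.smulRight (h v) := by ext; simp
  rw [e, LinearMap.trace_smulRight] at this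
  exact this

/-- The homomorphisms between spaces with two marked endomorphisms each. -/
def homs (p : End K V × End K V) (p' : End K W × End K W) : Submodule K (V →ₗ[K] W) where
  carrier := {h | h ∘ₗ p.1 = p'.1 ∘ₗ h ∧ h ∘ₗ p.2 = p'.2 ∘ₗ h}
  zero_mem' := by simp
  add_mem' := by
    rintro a b ⟨h1, h2⟩ ⟨h3, h4⟩
    simp [LinearMap.add_comp, LinearMap.comp_add, h1, h2, h3, h4]
  smul_mem' := by
    rintro c a ⟨h1, h2⟩
    simp [LinearMap.smul_comp, LinearMap.comp_smul, h1, h2]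

/-- The map whose kernel describes the commuting block triangular pairs with given diagonal. -/
def commDefect (p : End K V × End K V) (p' : End K W × End K W) :
    (W →ₗ[K] V) × (W →ₗ[K] V) →ₗ[K] (W →ₗ[K] V) where
  toFun x := (p.1 ∘ₗ x.2 + x.1 ∘ₗ p'.2) - (p.2 ∘ₗ x.1 + x.2 ∘ₗ p'.1)
  map_add' x y := by
    simp only [Prod.fst_add, Prod.snd_add, LinearMap.comp_add, LinearMap.add_comp]; abel
  map_smul' c x := by
    simp only [Prod.smul_fst, Prod.smul_snd, LinearMap.comp_smul, LinearMap.smul_comp,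
      RingHom.id_apply, smul_sub, smul_add]

/-- The trace pairing as a map from `Hom(V, W)` to the dual of `Hom(W, V)`. -/
noncomputable def traceDual : (V →ₗ[K] W) →ₗ[K] Dual K (W →ₗ[K] V) where
  toFun h := LinearMap.trace K W ∘ₗ LinearMap.llcomp K W V W h
  map_add' x y := by ext; simp
  map_smul' c x := by ext; simp

theorem traceDual_bijective : Function.Bijective (traceDual (K := K) (V := V) (W := W)) := by
  have hi : Function.Injective (traceDual (K := K) (V := V) (W := W)) := by
    rw [injective_iff_map_eq_zero]
    intro h hh
    exact eq_zero_of_trace_comp_eq_zero h fun c => LinearMap.congr_fun hh c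
  refine ⟨hi, (LinearMap.injective_iff_surjective_of_finrank_eq_finrank ?_).1 hi⟩
  rw [Subspace.dual_finrank_eq, finrank_linearMap, finrank_linearMap, mul_comm]

-- Cyclicity of the trace moves the endomorphisms from x onto h, leaving the two commutation defects
-- of h paired with the independent entries x.2 and x.1.
omit [FiniteDimensional K V] in
theorem mem_homs_iff_traceDual (p : End K V × End K V) (p' : End K W × End K W)
    (h : V →ₗ[K] W) :
    h ∈ homs p p' ↔ traceDual h ∈ (commDefect p p').range.dualAnnihilator := by
  have key : ∀ x : (W →ₗ[K] V) × (W →ₗ[K] V), traceDual h (commDefect p p' x) =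
      LinearMap.trace K W ((h ∘ₗ p.1 - p'.1 ∘ₗ h) ∘ₗ x.2) -
        LinearMap.trace K W ((h ∘ₗ p.2 - p'.2 ∘ₗ h) ∘ₗ x.1) := by
    intro x
    have e1 := LinearMap.trace_comp_comm' (p'.2) (h ∘ₗ x.1)
    have e2 := LinearMap.trace_comp_comm' (p'.1) (h ∘ₗ x.2)
    simp only [traceDual, commDefect, LinearMap.coe_mk, AddHom.coe_mk, LinearMap.comp_apply,
      LinearMap.llcomp_apply', LinearMap.sub_comp,
      map_sub, map_add, ← LinearMap.comp_assoc] at e1 e2 ⊢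
    rw [e1, e2]
    ring
  rw [Submodule.mem_dualAnnihilator]
  constructor
  · rintro ⟨h1, h2⟩ _ ⟨x, rfl⟩
    rw [key, h1, h2]; simp
  · intro H
    constructor
    · refine sub_eq_zero.1 (eq_zero_of_trace_comp_eq_zero _ fun c => ?_)
      have := H _ ⟨(0, c), rfl⟩
      rw [key] at this
      simpa using this
    · refine sub_eq_zero.1 (eq_zero_of_trace_comp_eq_zero _ fun c => ?_)
      have := H _ ⟨(c, 0), rfl⟩
      rw [key] at this
      simpa using this

/-- `homs p p'` is dual to the cokernel of `commDefect p p'`, whose source has twice the dimension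
of its target; rank-nullity does the rest. -/
theorem finrank_ker_commDefect (p : End K V × End K V) (p' : End K W × End K W) :
    finrank K (commDefect p p').ker = finrank K (W →ₗ[K] V) + finrank K (homs p p') := by
  have e : finrank K (homs p p') = finrank K (commDefect p p').range.dualAnnihilator := by
    have : homs p p' = ((commDefect p p').range.dualAnnihilator).comap
        (LinearEquiv.ofBijective _ traceDual_bijective).toLinearMap := by
      ext h
      exact mem_homs_iff_traceDual p p' h
    rw [this]
    exact LinearEquiv.finrank_eq (LinearEquiv.ofSubmodule' _ _)
  have h1 := Subspace.finrank_add_finrank_dualAnnihilator_eq (commDefect p p').range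
  have h2 := (commDefect p p').finrank_range_add_finrank_ker
  rw [finrank_prod] at h2
  omega

theorem natCard_ker_commDefect [Finite K] (p : End K V × End K V) (p' : End K W × End K W) :
    Nat.card (commDefect p p').ker = Nat.card (W →ₗ[K] V) * Nat.card (homs p p') := by
  rw [Module.natCard_eq_pow_finrank (K := K),
    Module.natCard_eq_pow_finrank (K := K) (V := W →ₗ[K] V),
    Module.natCard_eq_pow_finrank (K := K) (V := homs p p'), finrank_ker_commDefect, pow_add]

end TraceDuality

end Parabolic

namespace Parabolic

/-! ### Block triangular endomorphisms and pairs over a fixed quotient -/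

section BlockEnd

variable {K V W : Type*} [Field K] [AddCommGroup V] [Module K V] [AddCommGroup W] [Module K W]

/-- The commuting pairs consisting of an invertible and a nilpotent endomorphism. -/
def commPairs (K V : Type*) [Field K] [AddCommGroup V] [Module K V] : Set (End K V × End K V) :=
  {p | Commute p.1 p.2 ∧ IsUnit p.1 ∧ IsNilpotent p.2}

/-- The block upper triangular endomorphism of `V × W` with the given blocks. -/
def blockEnd (a : End K V) (b : W →ₗ[K] V) (e : End K W) : End K (V × W) :=
  LinearMap.prod (LinearMap.coprod a b) (e ∘ₗ LinearMap.snd K V W)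

@[simp] theorem blockEnd_apply (a : End K V) (b : W →ₗ[K] V) (e : End K W) (x : V × W) :
    blockEnd a b e x = (a x.1 + b x.2, e x.2) := rfl

theorem blockEnd_mul (a a' : End K V) (b b' : W →ₗ[K] V) (e e' : End K W) :
    blockEnd a b e * blockEnd a' b' e' =
      blockEnd (a * a') (a ∘ₗ b' + b ∘ₗ e') (e * e') := by
  refine LinearMap.ext fun x => ?_
  simp [Module.End.mul_apply, add_assoc]

theorem blockEnd_one : blockEnd (1 : End K V) (0 : W →ₗ[K] V) (1 : End K W) = 1 := by
  refine LinearMap.ext fun x => ?_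
  simp

theorem blockEnd_zero : blockEnd (0 : End K V) (0 : W →ₗ[K] V) (0 : End K W) = 0 := by
  refine LinearMap.ext fun x => ?_
  simp

theorem blockEnd_inj {a a' : End K V} {b b' : W →ₗ[K] V} {e e' : End K W} :
    blockEnd a b e = blockEnd a' b' e' ↔ a = a' ∧ b = b' ∧ e = e' := by
  refine ⟨fun h => ?_, by rintro ⟨rfl, rfl, rfl⟩; rfl⟩
  refine ⟨?_, ?_, ?_⟩
  · ext v
    simpa using congrArg Prod.fst (LinearMap.congr_fun h (v, 0))
  · ext w
    simpa using congrArg Prod.fst (LinearMap.congr_fun h (0, w))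
  · ext w
    simpa using congrArg Prod.snd (LinearMap.congr_fun h (0, w))

theorem exists_blockEnd_pow (a : End K V) (b : W →ₗ[K] V) (e : End K W) (n : ℕ) :
    ∃ b', blockEnd a b e ^ n = blockEnd (a ^ n) b' (e ^ n) := by
  induction n with
  | zero => exact ⟨0, by simp [blockEnd_one]⟩
  | succ n ih =>
    obtain ⟨b', h⟩ := ih
    exact ⟨_, by rw [pow_succ, h, blockEnd_mul, ← pow_succ, ← pow_succ]⟩

theorem isNilpotent_blockEnd (a : End K V) (b : W →ₗ[K] V) (e : End K W) :
    IsNilpotent (blockEnd a b e) ↔ IsNilpotent a ∧ IsNilpotent e := by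
  constructor
  · rintro ⟨n, hn⟩
    obtain ⟨b', h⟩ := exists_blockEnd_pow a b e n
    rw [h, ← blockEnd_zero, blockEnd_inj] at hn
    exact ⟨⟨n, hn.1⟩, ⟨n, hn.2.2⟩⟩
  · rintro ⟨⟨n, hn⟩, ⟨k, hk⟩⟩
    obtain ⟨b', h⟩ := exists_blockEnd_pow a b e (n + k)
    -- The power n + k kills both diagonal blocks; squaring it then kills the remaining off-diagonal
    -- block.
    refine ⟨(n + k) + (n + k), ?_⟩
    have h1 : a ^ (n + k) = 0 := by rw [pow_add, hn, zero_mul]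
    have h2 : e ^ (n + k) = 0 := by rw [pow_add, hk, mul_zero]
    rw [pow_add, h, h1, h2, blockEnd_mul]
    simp [blockEnd_zero]

theorem isUnit_blockEnd_of (a : End K V) (b : W →ₗ[K] V) (e : End K W)
    (ha : IsUnit a) (he : IsUnit e) : IsUnit (blockEnd a b e) := by
  obtain ⟨a, rfl⟩ := ha
  obtain ⟨e, rfl⟩ := he
  refine ⟨⟨blockEnd a.1 b e.1, blockEnd (a⁻¹).1 (-((a⁻¹).1 ∘ₗ b ∘ₗ (e⁻¹).1)) (e⁻¹).1, ?_, ?_⟩,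
    rfl⟩
  · rw [blockEnd_mul, ← blockEnd_one, blockEnd_inj]
    refine ⟨a.mul_inv, ?_, e.mul_inv⟩
    rw [LinearMap.comp_neg, ← LinearMap.comp_assoc]
    have : a.1 ∘ₗ (a⁻¹).1 = LinearMap.id := a.mul_inv
    rw [this]; simp
  · rw [blockEnd_mul, ← blockEnd_one, blockEnd_inj]
    refine ⟨a.inv_mul, ?_, e.inv_mul⟩
    have : (e⁻¹).1 ∘ₗ e.1 = LinearMap.id := e.inv_mul
    rw [LinearMap.neg_comp, LinearMap.comp_assoc, LinearMap.comp_assoc, this]; simp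

/-- Injectivity passes to the subspace V and surjectivity to the quotient W; in finite dimension
each is equivalent to invertibility. -/
theorem isUnit_blockEnd [FiniteDimensional K V] [FiniteDimensional K W]
    (a : End K V) (b : W →ₗ[K] V) (e : End K W) :
    IsUnit (blockEnd a b e) ↔ IsUnit a ∧ IsUnit e := by
  refine ⟨fun h => ⟨?_, ?_⟩, fun h => isUnit_blockEnd_of a b e h.1 h.2⟩
  · rw [LinearMap.isUnit_iff_ker_eq_bot] at h ⊢
    rw [LinearMap.ker_eq_bot'] at h ⊢
    intro v hv
    have := h (v, 0) (by simp [hv])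
    simpa using this
  · rw [LinearMap.isUnit_iff_range_eq_top] at h ⊢
    rw [LinearMap.range_eq_top] at h ⊢
    intro w
    obtain ⟨x, hx⟩ := h (0, w)
    exact ⟨x.2, by simpa using congrArg Prod.snd hx⟩

theorem eq_blockEnd_of_snd_comp {e : End K W} {f : End K (V × W)}
    (h : LinearMap.snd K V W ∘ₗ f = e ∘ₗ LinearMap.snd K V W) :
    f = blockEnd (LinearMap.fst K V W ∘ₗ f ∘ₗ LinearMap.inl K V W)
      (LinearMap.fst K V W ∘ₗ f ∘ₗ LinearMap.inr K V W) e := by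
  refine LinearMap.ext fun x => Prod.ext ?_ ?_
  · have : x = (x.1, 0) + (0, x.2) := by simp
    conv_lhs => rw [this, map_add]
    simp
  · exact LinearMap.congr_fun h x

theorem snd_comp_blockEnd (a : End K V) (b : W →ₗ[K] V) (e : End K W) :
    LinearMap.snd K V W ∘ₗ blockEnd a b e = e ∘ₗ LinearMap.snd K V W := rfl

theorem mem_commPairs_blockEnd [FiniteDimensional K V] [FiniteDimensional K W]
    (p : End K V × End K V) (p' : End K W × End K W) (x : (W →ₗ[K] V) × (W →ₗ[K] V)) :
    (blockEnd p.1 x.1 p'.1, blockEnd p.2 x.2 p'.2) ∈ commPairs K (V × W) ↔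
      p ∈ commPairs K V ∧ p' ∈ commPairs K W ∧ x ∈ (commDefect p p').ker := by
  simp only [commPairs, Set.mem_ofPred_eq, isUnit_blockEnd, isNilpotent_blockEnd, Commute,
    SemiconjBy, blockEnd_mul, blockEnd_inj, LinearMap.mem_ker, commDefect, LinearMap.coe_mk,
    AddHom.coe_mk, sub_eq_zero]
  tauto

/-- Commuting pairs on `V × W` that induce a given pair on `W`. -/
def commPairsOver (p' : End K W × End K W) : Set (End K (V × W) × End K (V × W)) :=
  {f | f ∈ commPairs K (V × W) ∧ LinearMap.snd K V W ∈ homs f p'}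

/-- Commuting pairs over `p'` in terms of their blocks. -/
def commPairsOverMk [FiniteDimensional K V] [FiniteDimensional K W]
    {p' : End K W × End K W} (hp' : p' ∈ commPairs K W)
    (y : Σ p : commPairs K V, (commDefect p.1 p').ker) : commPairsOver (V := V) p' :=
  ⟨(blockEnd y.1.1.1 y.2.1.1 p'.1, blockEnd y.1.1.2 y.2.1.2 p'.2),
    (mem_commPairs_blockEnd y.1.1 p' y.2.1).2 ⟨y.1.2, hp', y.2.2⟩,
    snd_comp_blockEnd _ _ _, snd_comp_blockEnd _ _ _⟩

theorem commPairsOverMk_bijective [FiniteDimensional K V] [FiniteDimensional K W]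
    {p' : End K W × End K W} (hp' : p' ∈ commPairs K W) :
    Function.Bijective (commPairsOverMk (V := V) hp') := by
  constructor
  · rintro ⟨⟨⟨a, b⟩, h⟩, ⟨⟨c, d⟩, h'⟩⟩ ⟨⟨⟨a₁, b₁⟩, h₁⟩, ⟨⟨c₁, d₁⟩, h₁'⟩⟩ H
    have H' := congrArg Subtype.val H
    simp only [commPairsOverMk, Prod.mk.injEq, blockEnd_inj] at H'
    obtain ⟨⟨rfl, rfl, -⟩, rfl, rfl, -⟩ := H'
    rfl
  · rintro ⟨⟨f, f'⟩, hf, h1, h2⟩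
    have h1 := eq_blockEnd_of_snd_comp h1
    have h2 := eq_blockEnd_of_snd_comp h2
    dsimp only at h1 h2
    have h := hf
    rw [h1, h2] at h
    have h' := (mem_commPairs_blockEnd (_, _) p' (_, _)).1 h
    exact ⟨⟨⟨_, h'.1⟩, ⟨_, h'.2.2⟩⟩, Subtype.ext (Prod.ext h1.symm h2.symm)⟩

/-- The number of triples `(g, T, h)` with `(g, T)` a commuting pair on `V` and `h` a homomorphism
from `(V, g, T)` to `(W, p')`. -/
noncomputable def homCount (V : Type*) [AddCommGroup V] [Module K V]
    (p' : End K W × End K W) : ℕ :=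
  Nat.card (Σ p : commPairs K V, homs p.1 p')

theorem natCard_commPairsOver [Finite K] [FiniteDimensional K V] [FiniteDimensional K W]
    {p' : End K W × End K W} (hp' : p' ∈ commPairs K W) :
    Nat.card (commPairsOver (V := V) p') = Nat.card (W →ₗ[K] V) * homCount V p' := by
  have : Finite V := Module.finite_of_finite K
  have : Finite W := Module.finite_of_finite K
  have : Finite (End K V) := Module.finite_of_finite K
  have : Fintype (commPairs K V) := Fintype.ofFinite _
  have : Finite (W →ₗ[K] V) := Module.finite_of_finite K
  have : Finite (V →ₗ[K] W) := Module.finite_of_finite K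
  rw [← Nat.card_congr (Equiv.ofBijective _ (commPairsOverMk_bijective hp')), Nat.card_sigma,
    homCount, Nat.card_sigma,
    Finset.mul_sum]
  exact Finset.sum_congr rfl fun p _ => natCard_ker_commDefect _ _

end BlockEnd

end Parabolic

namespace Parabolic

/-! ### Lifting commuting pairs along a surjection -/

section Transport

variable {K V V' W I : Type*} [Field K] [AddCommGroup V] [Module K V] [AddCommGroup V']
  [Module K V'] [AddCommGroup W] [Module K W] [AddCommGroup I] [Module K I]

theorem conj_mem_commPairs (e : V ≃ₗ[K] V') {p : End K V × End K V} (hp : p ∈ commPairs K V) :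
    (e.conjRingEquiv p.1, e.conjRingEquiv p.2) ∈ commPairs K V' :=
  ⟨hp.1.map _, hp.2.1.map _, hp.2.2.map _⟩

/-- Transport of commuting pairs along an isomorphism. -/
def commPairsCongr (e : V ≃ₗ[K] V') : commPairs K V ≃ commPairs K V' where
  toFun p := ⟨(e.conjRingEquiv p.1.1, e.conjRingEquiv p.1.2), conj_mem_commPairs e p.2⟩
  invFun p := ⟨(e.symm.conjRingEquiv p.1.1, e.symm.conjRingEquiv p.1.2),
    conj_mem_commPairs e.symm p.2⟩
  left_inv p := by ext <;> simp
  right_inv p := by ext <;> simp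

theorem comp_mem_homs_conj_iff (e : V ≃ₗ[K] V') (p : End K V × End K V)
    (p' : End K W × End K W) (h : V' →ₗ[K] W) :
    h ∘ₗ e.toLinearMap ∈ homs p p' ↔
      h ∈ homs (e.conjRingEquiv p.1, e.conjRingEquiv p.2) p' := by
  have key (a : End K V) (b : End K W) : (h ∘ₗ e.toLinearMap) ∘ₗ a = b ∘ₗ h ∘ₗ e.toLinearMap ↔
      h ∘ₗ e.conjRingEquiv a = b ∘ₗ h := by
    constructor
    · intro H
      ext x
      simpa using LinearMap.congr_fun H (e.symm x)
    · intro H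
      ext x
      simpa using LinearMap.congr_fun H (e x)
  exact and_congr (key _ _) (key _ _)

/-- A section of h splits V into ker h and I, and ker h is isomorphic to V' by dimension. -/
theorem exists_equiv_prod_snd_comp [FiniteDimensional K V] [FiniteDimensional K V']
    [FiniteDimensional K I] (hd : finrank K V' + finrank K I = finrank K V)
    (h : V →ₗ[K] I) (hs : Function.Surjective h) :
    ∃ e : V ≃ₗ[K] V' × I, LinearMap.snd K V' I ∘ₗ e.toLinearMap = h := by
  obtain ⟨s, hs'⟩ := h.exists_rightInverse_of_surjective (LinearMap.range_eq_top.2 hs)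
  have hk := h.finrank_range_add_finrank_ker
  rw [LinearMap.range_eq_top.2 hs, finrank_top] at hk
  have φ : h.ker ≃ₗ[K] V' := LinearEquiv.ofFinrankEq _ _ (by omega)
  have hc (v : V) : (LinearMap.id - s ∘ₗ h : V →ₗ[K] V) v ∈ h.ker := by
    have := LinearMap.congr_fun hs' (h v)
    simp only [LinearMap.comp_apply, LinearMap.id_apply] at this
    simp [this]
  let f : V →ₗ[K] V' × I :=
    LinearMap.prod (φ.toLinearMap ∘ₗ (LinearMap.id - s ∘ₗ h : V →ₗ[K] V).codRestrict h.ker hc) h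
  have hf : Function.Injective f := by
    rw [injective_iff_map_eq_zero]
    intro v hv
    have h2 : h v = 0 := congrArg Prod.snd hv
    have h1 : φ ((LinearMap.id - s ∘ₗ h : V →ₗ[K] V).codRestrict h.ker hc v) = 0 :=
      congrArg Prod.fst hv
    rw [map_eq_zero_iff φ φ.injective] at h1
    have := congrArg Subtype.val h1
    simpa [h2] using this
  exact ⟨LinearEquiv.ofInjectiveOfFinrankEq f hf (by rw [finrank_prod, hd]), by ext; rfl⟩

/-- After the splitting, h becomes the projection V' × I → I, so the pairs to be counted are exactly
those of `commPairsOver`. The count does not depend on h. -/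
theorem natCard_commPairs_lifting [Finite K] [FiniteDimensional K V] [FiniteDimensional K V']
    [FiniteDimensional K I] (hd : finrank K V' + finrank K I = finrank K V)
    {p' : End K I × End K I} (hp' : p' ∈ commPairs K I)
    (h : V →ₗ[K] I) (hs : Function.Surjective h) :
    Nat.card {p : commPairs K V // h ∈ homs p.1 p'} =
      Nat.card (I →ₗ[K] V') * homCount V' p' := by
  obtain ⟨e, rfl⟩ := exists_equiv_prod_snd_comp (V' := V') hd h hs
  rw [← natCard_commPairsOver hp']
  have E : {p : commPairs K V // LinearMap.snd K V' I ∘ₗ e.toLinearMap ∈ homs p.1 p'} ≃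
      {p : commPairs K (V' × I) // LinearMap.snd K V' I ∈ homs p.1 p'} :=
    Equiv.subtypeEquiv (commPairsCongr e) fun p => comp_mem_homs_conj_iff e p.1 p' _
  exact Nat.card_congr (E.trans ⟨fun x => ⟨x.1.1, x.1.2, x.2⟩, fun y => ⟨⟨y.1, y.2.1⟩, y.2.2⟩,
    fun _ => rfl, fun _ => rfl⟩)

end Transport

/-! ### The order of GL(V) in terms of surjections -/

section CountingIsos

variable (K V V' I : Type*) [Field K] [AddCommGroup V] [Module K V] [AddCommGroup V']
  [Module K V'] [AddCommGroup I] [Module K I]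

/-- The order of the general linear group of `V`. -/
noncomputable def glCard : ℕ := Nat.card (End K V)ˣ

theorem glCard_pos [Finite K] [FiniteDimensional K V] : 0 < glCard K V := by
  have : Finite V := Module.finite_of_finite K
  have : Finite (End K V) := Module.finite_of_finite K
  exact Nat.card_pos

variable {V V'} in
theorem natCard_bijective_eq_glCard (e : V ≃ₗ[K] V') :
    Nat.card {f : V →ₗ[K] V' // Function.Bijective f} = glCard K V := by
  symm
  refine Nat.card_congr (Equiv.ofBijective (fun u => ⟨e.toLinearMap ∘ₗ u.1,
    e.bijective.comp ((Module.End.isUnit_iff _).1 u.isUnit)⟩) ⟨fun u u' H => ?_, fun f => ?_⟩)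
  · refine Units.ext (LinearMap.ext fun x => e.injective ?_)
    exact LinearMap.congr_fun (congrArg Subtype.val H) x
  · have hu : IsUnit (e.symm.toLinearMap ∘ₗ f.1) :=
      (Module.End.isUnit_iff _).2 (e.symm.bijective.comp f.2)
    refine ⟨hu.unit, Subtype.ext ?_⟩
    ext x
    simp

variable {V V' I}

/-- Choose a splitting e_h for each surjection h. Every isomorphism f : V → V' × I is uniquely a
block triangular map with lower block 1 composed with e_h, where h is the second component of f. -/
theorem glCard_eq [Finite K] [FiniteDimensional K V] [FiniteDimensional K V']
    [FiniteDimensional K I] (hd : finrank K V' + finrank K I = finrank K V) :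
    glCard K V = Nat.card {h : V →ₗ[K] I // Function.Surjective h} *
      (glCard K V' * Nat.card (I →ₗ[K] V')) := by
  choose e he using fun h : {h : V →ₗ[K] I // Function.Surjective h} =>
    exists_equiv_prod_snd_comp (V' := V') hd h.1 h.2
  rw [← natCard_bijective_eq_glCard (V' := V' × I) K
    (LinearEquiv.ofFinrankEq V (V' × I) (by rw [finrank_prod, hd])), glCard, ← Nat.card_prod,
    ← Nat.card_prod]
  symm
  refine Nat.card_congr (Equiv.ofBijective (fun x => ⟨blockEnd x.2.1.1 x.2.2 1 ∘ₗ
    (e x.1).toLinearMap, ?_⟩) ⟨?_, ?_⟩)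
  · exact ((Module.End.isUnit_iff _).1
      (isUnit_blockEnd_of _ _ _ x.2.1.isUnit isUnit_one)).comp (e x.1).bijective
  · rintro ⟨h, a, b⟩ ⟨h', a', b'⟩ H
    have H1 : blockEnd a.1 b 1 ∘ₗ (e h).toLinearMap = blockEnd a'.1 b' 1 ∘ₗ (e h').toLinearMap :=
      congrArg Subtype.val H
    have H2 : h = h' := by
      apply Subtype.ext
      rw [← he h, ← he h']
      have := congrArg (fun f => LinearMap.snd K V' I ∘ₗ f) H1
      simpa only [← LinearMap.comp_assoc, snd_comp_blockEnd, Module.End.one_eq_id,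
        LinearMap.id_comp] using this
    subst H2
    have H3 : blockEnd a.1 b 1 = blockEnd a'.1 b' (1 : End K I) := by
      refine LinearMap.ext fun x => ?_
      obtain ⟨y, rfl⟩ := (e h).surjective x
      exact LinearMap.congr_fun H1 y
    rw [blockEnd_inj] at H3
    obtain ⟨H3, rfl, -⟩ := H3
    rw [Units.ext H3]
  · rintro ⟨f, hf⟩
    have hs : Function.Surjective (LinearMap.snd K V' I ∘ₗ f) :=
      (LinearMap.snd_surjective (R := K) (M := V') (M₂ := I)).comp hf.2
    let g : End K (V' × I) := f ∘ₗ (e ⟨_, hs⟩).symm.toLinearMap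
    have hg : LinearMap.snd K V' I ∘ₗ g = (1 : End K I) ∘ₗ LinearMap.snd K V' I := by
      refine LinearMap.ext fun x => ?_
      obtain ⟨y, rfl⟩ := (e ⟨_, hs⟩).surjective x
      have := LinearMap.congr_fun (he ⟨_, hs⟩) y
      simp only [LinearMap.comp_apply, LinearEquiv.coe_coe] at this
      simpa [g] using this.symm
    have hu : IsUnit g := (Module.End.isUnit_iff _).2 (hf.comp (e ⟨_, hs⟩).symm.bijective)
    rw [eq_blockEnd_of_snd_comp hg, isUnit_blockEnd] at hu
    refine ⟨⟨⟨_, hs⟩, hu.1.unit, LinearMap.fst K V' I ∘ₗ g ∘ₗ LinearMap.inr K V' I⟩, ?_⟩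
    apply Subtype.ext
    dsimp only
    rw [IsUnit.unit_spec, ← eq_blockEnd_of_snd_comp hg]
    ext <;> simp [g]

end CountingIsos

/-! ### The recursion over invariant subspaces -/

section Recursion

variable {K V W : Type*} [Field K] [AddCommGroup V] [Module K V] [AddCommGroup W] [Module K W]

/-- The subspaces invariant under both endomorphisms of a pair. -/
abbrev InvSub (p : End K W × End K W) : Type _ :=
  {I : Submodule K W // (∀ x ∈ I, p.1 x ∈ I) ∧ (∀ x ∈ I, p.2 x ∈ I)}

/-- The restriction of a pair of endomorphisms to an invariant subspace. -/
def InvSub.restr {p : End K W × End K W} (I : InvSub p) : End K I.1 × End K I.1 :=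
  (p.1.restrict I.2.1, p.2.restrict I.2.2)

theorem InvSub.restr_mem [FiniteDimensional K W] {p : End K W × End K W} (hp : p ∈ commPairs K W)
    (I : InvSub p) : I.restr ∈ commPairs K I.1 := by
  obtain ⟨h1, h2, n, h3⟩ := hp
  refine ⟨?_, ?_, n, ?_⟩
  · refine LinearMap.ext fun x => Subtype.ext ?_
    exact LinearMap.congr_fun h1.eq x.1
  · rw [LinearMap.isUnit_iff_ker_eq_bot, LinearMap.ker_eq_bot'] at h2 ⊢
    intro x hx
    exact Subtype.ext (h2 x.1 (congrArg Subtype.val hx))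
  · refine LinearMap.ext fun x => Subtype.ext ?_
    simp only [InvSub.restr]
    rw [Module.End.pow_restrict]
    simp [h3]

/-- The image of a homomorphism as an invariant subspace. -/
def rangeInv {p : End K V × End K V} {p' : End K W × End K W} (h : homs p p') : InvSub p' :=
  ⟨h.1.range, by
    constructor
    · rintro _ ⟨x, rfl⟩
      exact ⟨p.1 x, LinearMap.congr_fun h.2.1 x⟩
    · rintro _ ⟨x, rfl⟩
      exact ⟨p.2 x, LinearMap.congr_fun h.2.2 x⟩⟩

theorem subtype_comp_mem_homs {p : End K V × End K V} {p' : End K W × End K W} (I : InvSub p')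
    (h : V →ₗ[K] I.1) : I.1.subtype ∘ₗ h ∈ homs p p' ↔ h ∈ homs p I.restr := by
  have key (a : End K V) (b : End K W) (hb : ∀ x ∈ I.1, b x ∈ I.1) :
      (I.1.subtype ∘ₗ h) ∘ₗ a = b ∘ₗ I.1.subtype ∘ₗ h ↔ h ∘ₗ a = b.restrict hb ∘ₗ h := by
    constructor
    · intro H
      exact LinearMap.ext fun x => Subtype.ext (LinearMap.congr_fun H x)
    · intro H
      exact LinearMap.ext fun x => congrArg Subtype.val (LinearMap.congr_fun H x)
  exact and_congr (key _ _ I.2.1) (key _ _ I.2.2)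

/-- Each homomorphism factors uniquely as a surjection onto its image, which is an invariant
subspace, followed by the inclusion. -/
theorem homCount_eq_sum_surjective [Finite K] [FiniteDimensional K V] [FiniteDimensional K W]
    (p' : End K W × End K W) [Fintype (InvSub p')] :
    homCount V p' = ∑ I : InvSub p', Nat.card (Σ h : {h : V →ₗ[K] I.1 // Function.Surjective h},
      {p : commPairs K V // h.1 ∈ homs p.1 I.restr}) := by
  have : Finite V := Module.finite_of_finite K
  have : Finite W := Module.finite_of_finite K
  have : Finite (End K V) := Module.finite_of_finite K
  have : Finite (V →ₗ[K] W) := Module.finite_of_finite K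
  have (I : InvSub p') : Finite (V →ₗ[K] I.1) := Module.finite_of_finite K
  rw [homCount, ← Nat.card_sigma]
  symm
  refine Nat.card_congr (Equiv.ofBijective (fun x => ⟨x.2.2.1,
    x.1.1.subtype ∘ₗ x.2.1.1, (subtype_comp_mem_homs x.1 x.2.1.1).2 x.2.2.2⟩) ⟨?_, ?_⟩)
  · rintro ⟨⟨I, hI⟩, ⟨h, hs⟩, p, hp⟩ ⟨⟨I', hI'⟩, ⟨h', hs'⟩, p', hp'⟩ H
    obtain rfl : p = p' := congrArg Sigma.fst H
    have H2 : I.subtype ∘ₗ h = I'.subtype ∘ₗ h' :=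
      congrArg Subtype.val (eq_of_heq (Sigma.mk.inj H).2)
    obtain rfl : I = I' := by
      have := congrArg LinearMap.range H2
      rwa [LinearMap.range_comp, LinearMap.range_comp, LinearMap.range_eq_top.2 hs,
        LinearMap.range_eq_top.2 hs', Submodule.map_subtype_top, Submodule.map_subtype_top] at this
    obtain rfl : h = h' := LinearMap.ext fun x => Subtype.ext (LinearMap.congr_fun H2 x)
    rfl
  · rintro ⟨p, h⟩
    refine ⟨⟨rangeInv h, ⟨h.1.rangeRestrict, h.1.surjective_rangeRestrict⟩, p, ?_⟩, ?_⟩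
    · rw [← subtype_comp_mem_homs]
      exact h.2
    · rfl

/-- Dividing by |GL(V)| cancels both the number of surjections V → I and the factor |Hom(I, V')|, by
`glCard_eq`. Subspaces larger than V receive no surjection. -/
theorem homCount_eq_sum [Finite K] [FiniteDimensional K V] [FiniteDimensional K W]
    {p' : End K W × End K W} (hp' : p' ∈ commPairs K W) [Fintype (InvSub p')] :
    (homCount V p' : ℚ) / glCard K V = ∑ I : InvSub p', if finrank K I.1 ≤ finrank K V then
      (homCount (Fin (finrank K V - finrank K I.1) → K) I.restr : ℚ) /
        glCard K (Fin (finrank K V - finrank K I.1) → K) else 0 := by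
  have : Finite V := Module.finite_of_finite K
  have : Finite W := Module.finite_of_finite K
  have : Finite (End K V) := Module.finite_of_finite K
  have (I : InvSub p') : Finite (V →ₗ[K] I.1) := Module.finite_of_finite K
  rw [homCount_eq_sum_surjective, Nat.cast_sum, Finset.sum_div]
  refine Finset.sum_congr rfl fun I _ => ?_
  split_ifs with h
  · have hd : finrank K (Fin (finrank K V - finrank K I.1) → K) + finrank K I.1 = finrank K V := by
      rw [finrank_fin_fun]; omega
    have := Fintype.ofFinite {h : V →ₗ[K] I.1 // Function.Surjective h}
    rw [Nat.card_sigma, Finset.sum_congr rfl fun h _ =>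
      natCard_commPairs_lifting hd (InvSub.restr_mem hp' I) h.1 h.2, Finset.sum_const,
      Finset.card_univ, glCard_eq K hd, smul_eq_mul, ← Nat.card_eq_fintype_card]
    have h0 := glCard_pos K V
    rw [glCard_eq K hd] at h0
    have h1 := Nat.pos_of_mul_pos_left h0
    have h2 := Nat.pos_of_mul_pos_left h1
    have h3 := Nat.pos_of_mul_pos_right h1
    have h4 := Nat.pos_of_mul_pos_right h0
    push_cast
    field_simp
  · have : IsEmpty {h : V →ₗ[K] I.1 // Function.Surjective h} :=
      ⟨fun f => h (LinearMap.finrank_le_finrank_of_surjective f.2)⟩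
    simp

end Recursion

end Parabolic

namespace Parabolic

/-! ### Adapted bases and invariant complete flags -/

section AdaptedBases

variable {K W : Type*} [Field K] [AddCommGroup W] [Module K W]

/-- A linearly independent tuple all of whose initial segments span subspaces invariant under the
given pair. -/
def IsAdapted (p : End K W × End K W) {n : ℕ} (v : Fin n → W) : Prop :=
  LinearIndependent K v ∧ ∀ i, p.1 (v i) ∈ Submodule.span K (v '' Set.Iic i) ∧
    p.2 (v i) ∈ Submodule.span K (v '' Set.Iic i)

/-- The number of adapted tuples of length `n`. -/
noncomputable def adaptedCount (p : End K W × End K W) (n : ℕ) : ℕ :=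
  Nat.card {v : Fin n → W // IsAdapted p v}

theorem adaptedCount_zero (p : End K W × End K W) : adaptedCount p 0 = 1 := by
  have : Unique {v : Fin 0 → W // IsAdapted p v} :=
    { default := ⟨Fin.elim0, linearIndependent_empty_type, fun i => i.elim0⟩
      uniq := fun v => Subtype.ext (Subsingleton.elim _ _) }
  exact Nat.card_unique

theorem snoc_image_Iic_castSucc {W : Type*} {n : ℕ} (u : Fin n → W) (w : W) (i : Fin n) :
    (Fin.snoc u w : Fin (n + 1) → W) '' Set.Iic i.castSucc = u '' Set.Iic i := by
  ext x
  constructor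
  · rintro ⟨j, hj, rfl⟩
    obtain ⟨j, rfl⟩ | rfl := j.eq_castSucc_or_eq_last
    · exact ⟨j, by simpa using hj, by simp⟩
    · exact absurd hj (by simp [Fin.le_def])
  · rintro ⟨j, hj, rfl⟩
    exact ⟨j.castSucc, by simpa using hj, by simp⟩

theorem isAdapted_snoc_iff [FiniteDimensional K W] {p : End K W × End K W} {n : ℕ}
    (hn : finrank K W = n + 1) (u : Fin n → W) (w : W) :
    IsAdapted p (Fin.snoc u w : Fin (n + 1) → W) ↔
      IsAdapted p u ∧ w ∉ Submodule.span K (Set.range u) := by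
  rw [IsAdapted, linearIndependent_finSnoc, Fin.forall_fin_succ', IsAdapted]
  simp only [snoc_image_Iic_castSucc, Fin.snoc_castSucc, Fin.snoc_last]
  constructor
  · rintro ⟨⟨h1, h2⟩, h3, -⟩
    exact ⟨⟨h1, h3⟩, h2⟩
  · rintro ⟨⟨h1, h2⟩, h3⟩
    refine ⟨⟨h1, h3⟩, h2, ?_⟩
    have hli : LinearIndependent K (Fin.snoc u w : Fin (n + 1) → W) :=
      linearIndependent_finSnoc.2 ⟨h1, h3⟩
    -- The last vector carries no invariance condition: by dimension the whole tuple spans W.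
    have htop : (Set.Iic (Fin.last n)) = Set.univ := by
      ext x; simp [Fin.le_last]
    rw [htop, Set.image_univ, hli.span_eq_top_of_card_eq_finrank' (by simp [hn])]
    simp

theorem isAdapted_subtype_comp_iff {p : End K W × End K W} (I : InvSub p) {n : ℕ}
    (u : Fin n → I.1) : IsAdapted p (fun i => (u i : W)) ↔ IsAdapted I.restr u := by
  have h1 : LinearIndependent K (fun i => (u i : W)) ↔ LinearIndependent K u :=
    LinearMap.linearIndependent_iff I.1.subtype (by simp)
  have h2 (x : I.1) (i : Fin n) : (x : W) ∈ Submodule.span K ((fun i => (u i : W)) '' Set.Iic i) ↔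
      x ∈ Submodule.span K (u '' Set.Iic i) := by
    have : (fun i => (u i : W)) '' Set.Iic i = I.1.subtype '' (u '' Set.Iic i) := by
      rw [Set.image_image]; rfl
    rw [this, Submodule.span_image]
    simp
  rw [IsAdapted, IsAdapted, h1]
  refine and_congr_right fun _ => forall_congr' fun i => ?_
  rw [← h2, ← h2]
  rfl

theorem span_range_subtype_comp [FiniteDimensional K W] {I : Submodule K W} {n : ℕ}
    {u : Fin n → I} (hu : LinearIndependent K u) (hI : finrank K I = n) :
    Submodule.span K (Set.range fun i => (u i : W)) = I := by
  have : (Set.range fun i => (u i : W)) = I.subtype '' (Set.range u) := by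
    rw [← Set.range_comp]; rfl
  rw [this, Submodule.span_image, hu.span_eq_top_of_card_eq_finrank' (by simp [hI])]
  simp

theorem IsAdapted.span_invariant {p : End K W × End K W} {n : ℕ} {u : Fin n → W}
    (hu : IsAdapted p u) : (∀ x ∈ Submodule.span K (Set.range u),
      p.1 x ∈ Submodule.span K (Set.range u)) ∧ (∀ x ∈ Submodule.span K (Set.range u),
      p.2 x ∈ Submodule.span K (Set.range u)) := by
  constructor
  · intro x hx
    refine Submodule.span_le (p := (Submodule.span K (Set.range u)).comap p.1).2 ?_ hx
    rintro _ ⟨i, rfl⟩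
    exact Submodule.span_mono (Set.image_subset_range _ _) (hu.2 i).1
  · intro x hx
    refine Submodule.span_le (p := (Submodule.span K (Set.range u)).comap p.2).2 ?_ hx
    rintro _ ⟨i, rfl⟩
    exact Submodule.span_mono (Set.image_subset_range _ _) (hu.2 i).2

/-- The first n vectors form an adapted basis of an invariant hyperplane, and the last is any of the
q^(n+1) - q^n vectors outside it. -/
theorem adaptedCount_succ [Finite K] [FiniteDimensional K W] (p : End K W × End K W) {n : ℕ}
    (hn : finrank K W = n + 1) [Fintype {I : InvSub p // finrank K I.1 = n}] :
    (adaptedCount p (n + 1) : ℚ) = ∑ I : {I : InvSub p // finrank K I.1 = n},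
      (adaptedCount I.1.restr n : ℚ) * ((Nat.card K : ℚ) ^ (n + 1) - (Nat.card K : ℚ) ^ n) := by
  have : Finite W := Module.finite_of_finite K
  have e : {v : Fin (n + 1) → W // IsAdapted p v} ≃ Σ I : {I : InvSub p // finrank K I.1 = n},
      {u : Fin n → I.1.1 // IsAdapted I.1.restr u} × {w : W // w ∉ I.1.1} := by
    symm
    refine Equiv.ofBijective (fun x => ⟨Fin.snoc (fun i => (x.2.1.1 i : W)) x.2.2.1, ?_⟩) ⟨?_, ?_⟩
    · rw [isAdapted_snoc_iff hn, isAdapted_subtype_comp_iff,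
        span_range_subtype_comp x.2.1.2.1 x.1.2]
      exact ⟨x.2.1.2, x.2.2.2⟩
    · rintro ⟨⟨⟨I, hI⟩, hd⟩, ⟨u, hu⟩, w, hw⟩ ⟨⟨⟨I', hI'⟩, hd'⟩, ⟨u', hu'⟩, w', hw'⟩ H
      have h : (Fin.snoc (fun i => (u i : W)) w : Fin (n + 1) → W) =
        Fin.snoc (fun i => (u' i : W)) w' := congrArg Subtype.val H
      obtain ⟨h1, rfl⟩ := Fin.snoc_inj.1 h
      obtain rfl : I = I' := by
        exact (span_range_subtype_comp hu.1 hd).symm.trans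
          ((congrArg (fun f => Submodule.span K (Set.range f)) h1).trans
            (span_range_subtype_comp hu'.1 hd'))
      obtain rfl : u = u' := funext fun i => Subtype.ext (congrFun h1 i)
      rfl
    · rintro ⟨v, hv⟩
      obtain ⟨u, w, rfl⟩ : ∃ u w, v = (Fin.snoc u w : Fin (n + 1) → W) :=
        ⟨Fin.init v, v (Fin.last n), (Fin.snoc_init_self v).symm⟩
      rw [isAdapted_snoc_iff hn] at hv
      let I : InvSub p := ⟨Submodule.span K (Set.range u), hv.1.span_invariant⟩
      refine ⟨⟨⟨I, ?_⟩, ⟨fun i => ⟨u i, Submodule.subset_span ⟨i, rfl⟩⟩, ?_⟩, ⟨w, hv.2⟩⟩, rfl⟩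
      · change finrank K (Submodule.span K (Set.range u)) = n
        rw [finrank_span_eq_card hv.1.1, Fintype.card_fin]
      · rw [← isAdapted_subtype_comp_iff I]
        exact hv.1
  rw [adaptedCount, Nat.card_congr e, Nat.card_sigma, Nat.cast_sum]
  refine Finset.sum_congr rfl fun I _ => ?_
  rw [Nat.card_prod, Nat.cast_mul, adaptedCount]
  congr 1
  have h1 : Nat.card I.1.1 + Nat.card {w : W // w ∉ I.1.1} = Nat.card W := by
    classical
    rw [← Nat.card_sum]
    exact Nat.card_congr (Equiv.sumCompl fun w => w ∈ I.1.1)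
  rw [Module.natCard_eq_pow_finrank (K := K) (V := I.1.1), I.2,
    Module.natCard_eq_pow_finrank (K := K) (V := W), hn] at h1
  rw [← Nat.cast_pow, ← Nat.cast_pow, ← h1]
  push_cast
  ring

end AdaptedBases

end Parabolic

namespace Parabolic

open PowerSeries

/-! ### Generating functions -/

section GeneratingFunction

variable {K : Type*} [Field K]

/-- The generating function of the normalised numbers of homomorphisms into `(W, p')`. -/
noncomputable def homSeries {W : Type*} [AddCommGroup W] [Module K W] (p' : End K W × End K W) :
    ℚ⟦X⟧ :=
  PowerSeries.mk fun j => (homCount (Fin j → K) p' : ℚ) / glCard K (Fin j → K)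

variable {W : Type*} [AddCommGroup W] [Module K W]

theorem homSeries_eq_sum [Finite K] [FiniteDimensional K W]
    {p' : End K W × End K W} (hp' : p' ∈ commPairs K W) [Fintype (InvSub p')] :
    homSeries p' = ∑ I : InvSub p', (X : ℚ⟦X⟧) ^ finrank K I.1 * homSeries I.restr := by
  ext j
  rw [homSeries, coeff_mk, homCount_eq_sum hp', map_sum]
  refine Finset.sum_congr rfl fun I _ => ?_
  rw [coeff_X_pow_mul', finrank_fin_fun, homSeries, coeff_mk]

theorem homSeries_restr_of_eq_top {p' : End K W × End K W} {I : InvSub p'} (hI : I.1 = ⊤) :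
    homSeries I.restr = homSeries p' := by
  ext j
  rw [homSeries, homSeries, coeff_mk, coeff_mk]
  congr 2
  refine Nat.card_congr (Equiv.sigmaCongrRight fun p => Equiv.ofBijective
    (fun h => ⟨I.1.subtype ∘ₗ h.1, (subtype_comp_mem_homs I h.1).2 h.2⟩) ⟨?_, ?_⟩)
  · intro h h' H
    exact Subtype.ext (LinearMap.ext fun x => Subtype.ext
      (LinearMap.congr_fun (congrArg Subtype.val H) x))
  · intro h
    refine ⟨⟨h.1.codRestrict I.1 fun x => by rw [hI]; trivial, ?_⟩, ?_⟩
    · rw [← subtype_comp_mem_homs]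
      exact h.2
    · rfl

/-- The summand I = W of `homSeries_eq_sum` is X^(dim W) times the series itself and is moved to the
left, leaving strictly smaller spaces to induct on. -/
theorem one_sub_mul_homSeries [Finite K] [FiniteDimensional K W]
    {p' : End K W × End K W} (hp' : p' ∈ commPairs K W) [Fintype {I : InvSub p' // I.1 ≠ ⊤}] :
    (1 - (X : ℚ⟦X⟧) ^ finrank K W) * homSeries p' =
      ∑ I : {I : InvSub p' // I.1 ≠ ⊤}, (X : ℚ⟦X⟧) ^ finrank K I.1.1 * homSeries I.1.restr := by
  classical
  have : Finite W := Module.finite_of_finite K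
  have : Finite (InvSub p') := Subtype.finite
  have : Fintype (InvSub p') := Fintype.ofFinite _
  let T : InvSub p' := ⟨⊤, fun _ _ => trivial, fun _ _ => trivial⟩
  have h := homSeries_eq_sum hp'
  rw [← Fintype.sum_subtype_add_sum_subtype (fun I : InvSub p' => I.1 ≠ ⊤)] at h
  have hu : Unique {I : InvSub p' // ¬ I.1 ≠ ⊤} :=
    { default := ⟨T, not_not.2 rfl⟩
      uniq := fun I => Subtype.ext (Subtype.ext (not_not.1 I.2)) }
  have h2 : ∑ I : {I : InvSub p' // ¬ I.1 ≠ ⊤}, (X : ℚ⟦X⟧) ^ finrank K I.1.1 *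
      homSeries I.1.restr = X ^ finrank K W * homSeries p' := by
    have hd := not_not.1 (default : {I : InvSub p' // ¬ I.1 ≠ ⊤}).2
    rw [Fintype.sum_unique, homSeries_restr_of_eq_top hd, hd, finrank_top]
  rw [h2] at h
  rw [sub_mul, one_mul, sub_eq_iff_eq_add]
  convert h

theorem homCount_of_finrank_eq_zero {V : Type*} [AddCommGroup V] [Module K V]
    [FiniteDimensional K W] (hW : finrank K W = 0) (p' : End K W × End K W) :
    homCount V p' = Nat.card (commPairs K V) := by
  have : Subsingleton W := finrank_zero_iff.1 hW
  refine Nat.card_congr ⟨fun x => x.1, fun p => ⟨p, 0⟩, fun x => ?_, fun _ => rfl⟩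
  have : x.2 = 0 := Subtype.ext (LinearMap.ext fun _ => Subsingleton.elim _ _)
  exact Sigma.ext rfl (heq_of_eq this.symm)

end GeneratingFunction

/-! ### Evaluation at X = 1 and the coefficients -/

section Evaluation

/-- The polynomial `∏ (1 - X ^ d)` over `a < d ≤ b`. -/
noncomputable def prodOneSub (R : Type*) [CommRing R] (a b : ℕ) : Polynomial R :=
  ∏ d ∈ Finset.Ico a b, (1 - Polynomial.X ^ (d + 1))

theorem natDegree_prodOneSub_le (a b : ℕ) :
    (prodOneSub ℚ a b).natDegree ≤ ∑ d ∈ Finset.Ico a b, (d + 1) := by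
  refine (Polynomial.natDegree_prod_le _ _).trans (Finset.sum_le_sum fun d _ => ?_)
  refine (Polynomial.natDegree_sub_le _ _).trans ?_
  simp

theorem eval_one_prodOneSub {a b : ℕ} (h : a ≤ b) :
    (prodOneSub ℚ a b).eval 1 = if a = b then 1 else 0 := by
  split_ifs with hab
  · simp [prodOneSub, hab]
  · rw [prodOneSub, Polynomial.eval_prod]
    exact Finset.prod_eq_zero (Finset.mem_Ico.2 ⟨le_rfl, lt_of_le_of_ne h hab⟩) (by simp)

theorem prodOneSub_mul {a b c : ℕ} (h1 : a ≤ b) (h2 : b ≤ c) :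
    prodOneSub ℚ a b * prodOneSub ℚ b c = prodOneSub ℚ a c :=
  Finset.prod_Ico_consecutive _ h1 h2

theorem map_prodOneSub (a b : ℕ) :
    (prodOneSub ℤ a b).map (Int.castRingHom ℚ) = prodOneSub ℚ a b := by
  simp [prodOneSub, Polynomial.map_prod]

/-- The product in the last clause is the order of the Borel group, so h(1) is the number of
complete invariant flags. P is the series of the zero space. -/
theorem exists_polynomial_homSeries {K : Type*} [Field K] [Finite K] (P : ℚ⟦X⟧)
    (hP : ∀ j, coeff j P = (Nat.card (commPairs K (Fin j → K)) : ℚ) / glCard K (Fin j → K))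
    (m : ℕ) : ∀ (W : Type*) [AddCommGroup W] [Module K W] [FiniteDimensional K W]
      (p' : End K W × End K W), p' ∈ commPairs K W → finrank K W = m →
      ∃ h : Polynomial ℚ, h.natDegree ≤ ∑ d ∈ Finset.range m, d ∧
        (prodOneSub ℚ 0 m : ℚ⟦X⟧) * homSeries p' = (h : ℚ⟦X⟧) * P ∧
        h.eval 1 * ∏ s ∈ Finset.range m, ((Nat.card K : ℚ) ^ (s + 1) - (Nat.card K : ℚ) ^ s) =
          adaptedCount p' m := by
  classical
  induction m using Nat.strong_induction_on with
  | _ m ih =>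
  intro W _ _ _ p' hp' hm
  obtain _ | m := m
  · refine ⟨1, by simp, ?_, ?_⟩
    · have : homSeries p' = P := by
        ext j
        rw [homSeries, coeff_mk, hP, homCount_of_finrank_eq_zero hm]
      simp [this, prodOneSub]
    · simp [adaptedCount_zero]
  · have : Finite W := Module.finite_of_finite K
    have : Finite (InvSub p') := Subtype.finite
    have : Fintype (InvSub p') := Fintype.ofFinite _
    have hlt (I : {I : InvSub p' // I.1 ≠ ⊤}) : finrank K I.1.1 < m + 1 :=
      hm ▸ Submodule.finrank_lt I.2
    choose h h1 h2 h3 using fun I : {I : InvSub p' // I.1 ≠ ⊤} =>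
      ih (finrank K I.1.1) (hlt I) I.1.1 I.1.restr (I.1.restr_mem hp') rfl
    -- For dim W = m + 1 the factor 1 - X^(m+1) is absorbed by the recursion. Of the factors with
    -- exponents 1, ..., m, those up to dim I turn H_I into h_I P, and the others remain.
    refine ⟨∑ I, Polynomial.X ^ finrank K I.1.1 * prodOneSub ℚ (finrank K I.1.1) m * h I,
      ?_, ?_, ?_⟩
    · refine Polynomial.natDegree_sum_le_of_forall_le _ _ fun I _ => ?_
      have hI := Nat.lt_succ_iff.1 (hlt I)
      refine Polynomial.natDegree_mul_le.trans ?_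
      have e1 : (Polynomial.X ^ finrank K I.1.1 * prodOneSub ℚ (finrank K I.1.1) m).natDegree ≤
          finrank K I.1.1 + ∑ d ∈ Finset.Ico (finrank K I.1.1) m, (d + 1) :=
        Polynomial.natDegree_mul_le.trans (add_le_add (by simp) (natDegree_prodOneSub_le _ _))
      -- With i = dim I, this is i + ((i+1) + ... + m) + (0 + ... + (i-1)) = 0 + ... + m.
      refine (add_le_add e1 (h1 I)).trans (le_of_eq ?_)
      rw [Finset.sum_range_succ' _ m, ← Finset.sum_range_add_sum_Ico _ hI, add_zero,
        add_comm (finrank K I.1.1), add_assoc, add_comm _ (∑ d ∈ Finset.range _, d),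
        ← Finset.sum_range_succ, Finset.sum_range_succ', add_zero, add_comm]
    · have e1 : (prodOneSub ℚ 0 (m + 1) : ℚ⟦X⟧) =
          (prodOneSub ℚ 0 m : ℚ⟦X⟧) * (1 - X ^ finrank K W) := by
        rw [prodOneSub, Finset.prod_Ico_succ_top (Nat.zero_le _), hm, ← prodOneSub]
        simp
      have e2 (g : {I : InvSub p' // I.1 ≠ ⊤} → Polynomial ℚ) :
          ((∑ I, g I : Polynomial ℚ) : ℚ⟦X⟧) = ∑ I, (g I : ℚ⟦X⟧) :=
        map_sum Polynomial.coeToPowerSeries.ringHom _ _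
      rw [e1, mul_assoc, one_sub_mul_homSeries hp', Finset.mul_sum, e2, Finset.sum_mul]
      refine Finset.sum_congr rfl fun I _ => ?_
      have hI := Nat.lt_succ_iff.1 (hlt I)
      rw [← prodOneSub_mul (Nat.zero_le _) hI]
      have := h2 I
      simp only [Polynomial.coe_mul, Polynomial.coe_pow, Polynomial.coe_X]
      linear_combination (X : ℚ⟦X⟧) ^ finrank K I.1.1 *
        (prodOneSub ℚ (finrank K I.1.1) m : ℚ⟦X⟧) * this
    · rw [adaptedCount_succ p' hm, Polynomial.eval_finsetSum, Finset.sum_mul]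
      have hne (I : InvSub p') (hI : finrank K I.1 = m) : I.1 ≠ ⊤ := by
        intro hI'
        rw [hI', finrank_top, hm] at hI
        omega
      symm
      -- At X = 1 the leftover factors vanish unless the product is empty, that is, unless I is a
      -- hyperplane.
      refine Finset.sum_bij_ne_zero (fun I _ _ => ⟨I.1, hne I.1 I.2⟩)
        (fun _ _ _ => Finset.mem_univ _) ?_ ?_ ?_
      · intro I _ _ I' _ _ H
        exact Subtype.ext (congrArg (fun J : {I : InvSub p' // I.1 ≠ ⊤} => J.1) H)
      · intro I _ hI
        have hI' : finrank K I.1.1 = m := by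
          by_contra hc
          apply hI
          rw [Polynomial.eval_mul, Polynomial.eval_mul,
            eval_one_prodOneSub (Nat.lt_succ_iff.1 (hlt I)), if_neg hc]
          simp
        refine ⟨⟨I.1, hI'⟩, Finset.mem_univ _, ?_, rfl⟩
        intro h0
        apply hI
        have := h3 I
        rw [hI'] at this
        rw [Finset.prod_range_succ]
        simp only [Polynomial.eval_mul, Polynomial.eval_pow, Polynomial.eval_X, one_pow, one_mul]
        rw [mul_assoc, ← mul_assoc (Polynomial.eval 1 (h I)), this, h0, mul_zero]
      · intro I _ _
        have := h3 ⟨I.1, hne I.1 I.2⟩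
        dsimp only at this
        rw [I.2] at this
        rw [Polynomial.eval_mul, Polynomial.eval_mul,
            eval_one_prodOneSub (Nat.lt_succ_iff.1 (hlt _)), if_pos I.2, Finset.prod_range_succ,
            ← this]
        simp only [Polynomial.eval_pow, Polynomial.eval_X, one_pow, one_mul]
        ring

theorem exists_coefficients (p : ℕ → ℤ) (hp0 : p 0 = 1) (m : ℕ) : ∃ a : ℕ → ℤ,
    ∀ {K : Type*} [Field K] [Finite K],
      (∀ j, (Nat.card (commPairs K (Fin j → K)) : ℚ) = p j * glCard K (Fin j → K)) →
      ∀ (W : Type*) [AddCommGroup W] [Module K W] [FiniteDimensional K W]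
        (p' : End K W × End K W), p' ∈ commPairs K W → finrank K W = m →
        (∑ j ∈ Finset.range (m * (m - 1) / 2 + 1),
          (a j : ℚ) * ((homCount (Fin j → K) p' : ℚ) / glCard K (Fin j → K))) *
          ∏ s ∈ Finset.range m, ((Nat.card K : ℚ) ^ (s + 1) - (Nat.card K : ℚ) ^ s) =
          adaptedCount p' m := by
  set n := m * (m - 1) / 2 with hn
  let P : ℤ⟦X⟧ := PowerSeries.mk p
  let E : ℤ⟦X⟧ := (prodOneSub ℤ 0 m : ℤ⟦X⟧) * PowerSeries.invOfUnit P 1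
  -- h(1) is the sum of the coefficients of H_W E in degrees 0, ..., n. The j-th coefficient of H_W
  -- meets exactly the coefficients of E in degrees 0, ..., n - j.
  refine ⟨fun j => ∑ i ∈ Finset.range (n + 1 - j), coeff i E, ?_⟩
  intro K _ _ hp W _ _ _ p' hp' hm
  -- The constant term p 0 = 1 makes P invertible over ℤ, hence the coefficients integral.
  have hPinv : P * PowerSeries.invOfUnit P 1 = 1 :=
    PowerSeries.mul_invOfUnit _ _ (by simp [P, ← coeff_zero_eq_constantCoeff_apply, hp0])
  obtain ⟨h, h1, h2, h3⟩ := exists_polynomial_homSeries (K := K) (P.map (Int.castRingHom ℚ))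
    (fun j => by
      have := glCard_pos K (Fin j → K)
      rw [hp j]
      field_simp
      simp [P]) m W p' hp' hm
  rw [← h3]
  congr 1
  have h4 : (h : ℚ⟦X⟧) = homSeries p' * E.map (Int.castRingHom ℚ) := by
    have hE : E.map (Int.castRingHom ℚ) = (prodOneSub ℚ 0 m : ℚ⟦X⟧) *
        (PowerSeries.invOfUnit P 1).map (Int.castRingHom ℚ) := by
      rw [map_mul, ← Polynomial.polynomial_map_coe, map_prodOneSub]
    have hPinv' := congrArg (PowerSeries.map (Int.castRingHom ℚ)) hPinv
    rw [map_mul, map_one] at hPinv'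
    rw [hE]
    linear_combination (-(PowerSeries.invOfUnit P 1).map (Int.castRingHom ℚ)) * h2 -
      (h : ℚ⟦X⟧) * hPinv'
  have h5 : h.natDegree < n + 1 := by
    rw [Finset.sum_range_id] at h1
    omega
  rw [Polynomial.eval_eq_sum_range' h5]
  have h6 (k : ℕ) : h.coeff k * 1 ^ k = ∑ x ∈ Finset.HasAntidiagonal.antidiagonal k,
      (homCount (Fin x.1 → K) p' : ℚ) / glCard K (Fin x.1 → K) * ((coeff x.2 E : ℤ) : ℚ) := by
    rw [one_pow, mul_one, ← Polynomial.coeff_coe, h4, coeff_mul]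
    simp [homSeries]
  simp only [h6, Finset.Nat.sum_antidiagonal_eq_sum_range_succ (fun i j =>
    (homCount (Fin i → K) p' : ℚ) / glCard K (Fin i → K) * ((coeff j E : ℤ) : ℚ))]
  rw [Finset.sum_range_diag_flip (n + 1) fun i j =>
    (homCount (Fin i → K) p' : ℚ) / glCard K (Fin i → K) * ((coeff j E : ℤ) : ℚ)]
  refine Finset.sum_congr rfl fun j _ => ?_
  rw [← Finset.mul_sum, mul_comm]
  push_cast
  rfl

end Evaluation

end Parabolic

namespace Parabolic

/-! ### Burnside's lemma -/

section Burnside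

variable {s : ℕ} (l : Fin s → ℕ) (K : Type u) [Field K]

/-- The commuting pairs of an invertible and a nilpotent block upper triangular matrix. -/
def blockPairs : Set (Matrix (Index l) (Index l) K × Matrix (Index l) (Index l) K) :=
  {A | (A.1.BlockTriangular (block l) ∧ A.2.BlockTriangular (block l)) ∧
    Commute A.1 A.2 ∧ IsUnit A.1 ∧ IsNilpotent A.2}

theorem smul_eq_iff_commute (g : parabolic l K) (x : nilpotents l K) :
    g • x = x ↔ Commute g.1.1 x.1 := by
  rw [Subtype.ext_iff]
  change g.1.1 * x.1 * (g⁻¹).1.1 = x.1 ↔ g.1.1 * x.1 = x.1 * g.1.1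
  exact Units.mul_inv_eq_iff_eq_mul g.1

/-- The points fixed by g are the nilpotent matrices commuting with g, so orbits times group order
counts commuting pairs. -/
theorem rho_mul_natCard_parabolic :
    rho l K * Nat.card (parabolic l K) = Nat.card (blockPairs l K) := by
  rw [rho, ← Nat.card_prod,
    ← Nat.card_congr (MulAction.sigmaFixedByEquivOrbitsProdGroup (parabolic l K) (nilpotents l K))]
  refine Nat.card_congr (Equiv.ofBijective (fun x => ⟨(x.1.1.1, x.2.1.1),
    ⟨x.1.2, x.2.1.2.1⟩, (smul_eq_iff_commute l K x.1 x.2.1).1 x.2.2, x.1.1.isUnit, x.2.1.2.2⟩)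
    ⟨?_, ?_⟩)
  · rintro ⟨⟨g, hg⟩, ⟨⟨x, hx⟩, h⟩⟩ ⟨⟨g', hg'⟩, ⟨⟨x', hx'⟩, h'⟩⟩ H
    have H' := congrArg Subtype.val H
    obtain ⟨h1, h2⟩ := Prod.mk.inj H'
    dsimp only at h1 h2
    obtain rfl := Units.ext h1
    obtain rfl := h2
    rfl
  · rintro ⟨⟨A, B⟩, ⟨h1, h2⟩, h3, h4, h5⟩
    obtain ⟨g, rfl⟩ : IsUnit A := h4
    exact ⟨⟨⟨g, h1⟩, ⟨⟨B, h2, h5⟩, (smul_eq_iff_commute l K ⟨g, h1⟩ ⟨B, h2, h5⟩).2 h3⟩⟩, rfl⟩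

theorem natCard_parabolic : Nat.card (parabolic l K) =
    Nat.card {A : Matrix (Index l) (Index l) K // A.BlockTriangular (block l) ∧ IsUnit A} := by
  refine Nat.card_congr (Equiv.ofBijective (fun g => ⟨g.1.1, g.2, g.1.isUnit⟩) ⟨?_, ?_⟩)
  · intro g g' H
    exact Subtype.ext (Units.ext (congrArg Subtype.val H))
  · rintro ⟨A, h, ⟨g, rfl⟩⟩
    exact ⟨⟨g, h⟩, rfl⟩

variable {l K}

theorem natCard_blockPairs_eq {V : Type*} [AddCommGroup V] [Module K V] {P : End K V → Prop}
    (Ψ : Matrix (Index l) (Index l) K ≃+* End K V)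
    (hP : ∀ A, A.BlockTriangular (block l) ↔ P (Ψ A)) :
    Nat.card (blockPairs l K) = Nat.card {f : commPairs K V // P f.1.1 ∧ P f.1.2} := by
  refine Nat.card_congr (Equiv.ofBijective (fun A => ⟨⟨(Ψ A.1.1, Ψ A.1.2),
    A.2.2.1.map Ψ, A.2.2.2.1.map Ψ, A.2.2.2.2.map Ψ⟩, (hP _).1 A.2.1.1, (hP _).1 A.2.1.2⟩) ⟨?_, ?_⟩)
  · rintro ⟨⟨A, B⟩, h⟩ ⟨⟨A', B'⟩, h'⟩ H
    have H' := congrArg (fun f => f.1.1) H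
    obtain ⟨h1, h2⟩ := Prod.mk.inj H'
    obtain rfl := Ψ.injective h1
    obtain rfl := Ψ.injective h2
    rfl
  · rintro ⟨⟨⟨a, b⟩, h1, h2, h3⟩, h4, h5⟩
    obtain ⟨A, rfl⟩ := Ψ.surjective a
    obtain ⟨B, rfl⟩ := Ψ.surjective b
    refine ⟨⟨(A, B), ⟨(hP A).2 h4, (hP B).2 h5⟩, ?_, ?_, ?_⟩, rfl⟩
    · exact Ψ.injective (by simpa using h1.eq)
    · simpa using h2.map Ψ.symm
    · simpa using h3.map Ψ.symm

theorem natCard_parabolic_eq {V : Type*} [AddCommGroup V] [Module K V] {P : End K V → Prop}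
    (Ψ : Matrix (Index l) (Index l) K ≃+* End K V)
    (hP : ∀ A, A.BlockTriangular (block l) ↔ P (Ψ A)) :
    Nat.card (parabolic l K) = Nat.card {f : End K V // P f ∧ IsUnit f} := by
  rw [natCard_parabolic]
  refine Nat.card_congr (Equiv.subtypeEquiv Ψ.toEquiv fun A => and_congr (hP A) ?_)
  exact (MulEquiv.isUnit_map Ψ).symm

end Burnside

/-! ### Two diagonal blocks -/

section TwoBlocks

variable {K : Type u} [Field K] {V W : Type*} [AddCommGroup V] [Module K V] [AddCommGroup W]
  [Module K W]

/-- The condition that an endomorphism of `V × W` preserves `V`. -/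
def PreservesLeft (f : End K (V × W)) : Prop := ∀ v : V, (f (v, 0)).2 = 0

theorem preservesLeft_blockEnd (a : End K V) (b : W →ₗ[K] V) (e : End K W) :
    PreservesLeft (blockEnd a b e) := by
  intro v; simp

theorem PreservesLeft.exists_blockEnd {f : End K (V × W)} (hf : PreservesLeft f) :
    ∃ a b e, f = blockEnd a b e := by
  refine ⟨_, _, LinearMap.snd K V W ∘ₗ f ∘ₗ LinearMap.inr K V W, eq_blockEnd_of_snd_comp ?_⟩
  refine LinearMap.ext fun x => ?_
  have h : (f x).2 = (f (x.1, 0)).2 + (f (0, x.2)).2 := by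
    rw [← Prod.snd_add, ← map_add]; simp
  simpa [hf x.1] using h

theorem natCard_preservesLeft_isUnit [FiniteDimensional K V] [FiniteDimensional K W] :
    Nat.card {f : End K (V × W) // PreservesLeft f ∧ IsUnit f} =
      glCard K V * Nat.card (W →ₗ[K] V) * glCard K W := by
  rw [glCard, glCard, ← Nat.card_prod, ← Nat.card_prod]
  symm
  refine Nat.card_congr (Equiv.ofBijective (fun x => ⟨blockEnd x.1.1.1 x.1.2 x.2.1,
    preservesLeft_blockEnd _ _ _, isUnit_blockEnd_of _ _ _ x.1.1.isUnit x.2.isUnit⟩) ⟨?_, ?_⟩)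
  · rintro ⟨⟨a, b⟩, e⟩ ⟨⟨a', b'⟩, e'⟩ H
    obtain ⟨h1, rfl, h3⟩ := blockEnd_inj.1 (congrArg Subtype.val H)
    obtain rfl := Units.ext h1
    obtain rfl := Units.ext h3
    rfl
  · rintro ⟨f, hf, hu⟩
    obtain ⟨a, b, e, rfl⟩ := hf.exists_blockEnd
    obtain ⟨⟨a, rfl⟩, ⟨e, rfl⟩⟩ := (isUnit_blockEnd _ _ _).1 hu
    exact ⟨((a, b), e), rfl⟩

/-- A pair preserving V induces a unique commuting pair on the quotient W; the count is sorted by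
it. -/
theorem natCard_preservesLeft_commPairs [Finite K] [FiniteDimensional K V] [FiniteDimensional K W]
    [Fintype (commPairs K W)] :
    Nat.card {f : commPairs K (V × W) // PreservesLeft f.1.1 ∧ PreservesLeft f.1.2} =
      ∑ p' : commPairs K W, Nat.card (W →ₗ[K] V) * homCount V p'.1 := by
  have : Finite (End K (V × W)) := Module.finite_of_finite K
  rw [← Finset.sum_congr rfl fun p' _ => natCard_commPairsOver (V := V) (Subtype.prop p'),
    ← Nat.card_sigma]
  symm
  have key {e : End K W} {f : End K (V × W)}
      (h : LinearMap.snd K V W ∘ₗ f = e ∘ₗ LinearMap.snd K V W) : PreservesLeft f := by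
    rw [eq_blockEnd_of_snd_comp h]
    exact preservesLeft_blockEnd _ _ _
  refine Nat.card_congr (Equiv.ofBijective (fun x => ⟨⟨x.2.1, x.2.2.1⟩,
    key x.2.2.2.1, key x.2.2.2.2⟩) ⟨?_, ?_⟩)
  · rintro ⟨⟨⟨a, b⟩, hp⟩, ⟨f, hf, h1, h2⟩⟩ ⟨⟨⟨a', b'⟩, hp'⟩, ⟨f', hf', h1', h2'⟩⟩ H
    obtain rfl : f = f' := congrArg (fun x => x.1.1) H
    have e (c c' : End K W) (h : c ∘ₗ LinearMap.snd K V W = c' ∘ₗ LinearMap.snd K V W) : c = c' :=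
      LinearMap.ext fun w => LinearMap.congr_fun h (0, w)
    obtain rfl := e a a' (h1.symm.trans h1')
    obtain rfl := e b b' (h2.symm.trans h2')
    rfl
  · rintro ⟨⟨⟨f, f'⟩, hf⟩, h1, h2⟩
    obtain ⟨a, b, e, rfl⟩ := PreservesLeft.exists_blockEnd h1
    obtain ⟨a', b', e', rfl⟩ := PreservesLeft.exists_blockEnd h2
    have := (mem_commPairs_blockEnd (a, a') (e, e') (b, b')).1 hf
    exact ⟨⟨⟨(e, e'), this.2.1⟩, ⟨_, hf, snd_comp_blockEnd _ _ _, snd_comp_blockEnd _ _ _⟩⟩, rfl⟩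

/-- The labels of a matrix with two diagonal blocks. -/
def sumToIndex (j m : ℕ) : Fin j ⊕ Fin m → Index ![j, m]
  | Sum.inl x => ⟨0, x⟩
  | Sum.inr y => ⟨1, y⟩

theorem sumToIndex_bijective (j m : ℕ) : Function.Bijective (sumToIndex j m) := by
  constructor
  · rintro (x | x) (y | y) h
    · exact congrArg Sum.inl (eq_of_heq (Sigma.mk.inj h).2)
    · exact absurd (Sigma.mk.inj h).1 (by decide)
    · exact absurd (Sigma.mk.inj h).1 (by decide)
    · exact congrArg Sum.inr (eq_of_heq (Sigma.mk.inj h).2)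
  · rintro ⟨i, x⟩
    match i, x with
    | 0, x => exact ⟨Sum.inl x, rfl⟩
    | 1, x => exact ⟨Sum.inr x, rfl⟩

variable (K)

/-- The standard basis of `K ^ j × K ^ m`, labelled as for block matrices. -/
noncomputable def twoBlockBasis (j m : ℕ) : Basis (Index ![j, m]) K ((Fin j → K) × (Fin m → K)) :=
  ((Pi.basisFun K (Fin j)).prod (Pi.basisFun K (Fin m))).reindex
    (Equiv.ofBijective _ (sumToIndex_bijective j m))

theorem blockTriangular_twoBlockBasis (j m : ℕ) (A : Matrix (Index ![j, m]) (Index ![j, m]) K) :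
    A.BlockTriangular (block ![j, m]) ↔
      PreservesLeft ((LinearMap.toMatrixAlgEquiv (twoBlockBasis K j m)).symm A) := by
  obtain ⟨f, rfl⟩ := (LinearMap.toMatrixAlgEquiv (twoBlockBasis K j m)).surjective A
  rw [AlgEquiv.symm_apply_apply]
  have hinv (z : Fin j ⊕ Fin m) : (Equiv.ofBijective _ (sumToIndex_bijective j m)).symm
      (sumToIndex j m z) = z := Equiv.ofBijective_symm_apply_apply _ _ z
  have key (x : Fin j) (y : Fin m) : LinearMap.toMatrixAlgEquiv (twoBlockBasis K j m) f
      (sumToIndex j m (Sum.inr y)) (sumToIndex j m (Sum.inl x)) = (f (Pi.single x 1, 0)).2 y := by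
    rw [LinearMap.toMatrixAlgEquiv_apply, twoBlockBasis, Basis.reindex_apply, hinv,
      Basis.repr_reindex_apply, hinv]
    simp
  constructor
  · intro h v
    have : LinearMap.snd K (Fin j → K) (Fin m → K) ∘ₗ f ∘ₗ LinearMap.inl K _ _ = 0 := by
      refine LinearMap.pi_ext' fun x => LinearMap.ext_ring (funext fun y => ?_)
      have h1 := h (i := sumToIndex j m (Sum.inr y)) (j := sumToIndex j m (Sum.inl x))
        (by simp [block, sumToIndex])
      rw [key] at h1
      simpa using h1
    exact LinearMap.congr_fun this v
  · intro h a b hab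
    obtain ⟨(x | x), rfl⟩ := (sumToIndex_bijective j m).2 a <;>
    obtain ⟨(y | y), rfl⟩ := (sumToIndex_bijective j m).2 b <;>
    simp only [block, sumToIndex, lt_self_iff_false] at hab
    · exact absurd hab (by decide)
    · rw [key, h]; rfl

/-- The factor |Hom(W, V)| produced by trace duality cancels the unipotent part of the parabolic
group. -/
theorem rho_two_mul_glCard [Finite K] (j m : ℕ) [Fintype (commPairs K (Fin m → K))] :
    (rho ![j, m] K : ℚ) * glCard K (Fin m → K) = ∑ p' : commPairs K (Fin m → K),
      (homCount (Fin j → K) p'.1 : ℚ) / glCard K (Fin j → K) := by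
  have h := rho_mul_natCard_parabolic ![j, m] K
  rw [natCard_parabolic_eq (LinearMap.toMatrixAlgEquiv (twoBlockBasis K j m)).symm.toRingEquiv
      (blockTriangular_twoBlockBasis K j m),
    natCard_blockPairs_eq (LinearMap.toMatrixAlgEquiv (twoBlockBasis K j m)).symm.toRingEquiv
      (blockTriangular_twoBlockBasis K j m), natCard_preservesLeft_isUnit,
    natCard_preservesLeft_commPairs, ← Finset.mul_sum] at h
  have : Finite ((Fin m → K) →ₗ[K] (Fin j → K)) := Module.finite_of_finite K
  have h1 : 0 < Nat.card ((Fin m → K) →ₗ[K] (Fin j → K)) := Nat.card_pos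
  have h2 := glCard_pos K (Fin j → K)
  have h3 : rho ![j, m] K * glCard K (Fin m → K) * glCard K (Fin j → K) =
      ∑ p' : commPairs K (Fin m → K), homCount (Fin j → K) p'.1 := by
    refine Nat.eq_of_mul_eq_mul_left h1 ?_
    rw [← h]; ring
  rw [← Finset.sum_div, eq_div_iff (by positivity)]
  exact_mod_cast h3

end TwoBlocks

end Parabolic

namespace Parabolic

/-! ### Blocks of size one -/

section UpperTriangular

variable {K : Type u} [Field K]

/-- The labels of a matrix all of whose diagonal blocks have size one. -/
def oneIndexEquiv (m : ℕ) : Fin m ≃ Index (fun _ : Fin m => 1) :=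
  (Equiv.sigmaUnique (Fin m) (fun _ => Fin 1)).symm

theorem prod_range_ite_lt (R : Type*) [CommMonoid R] (a b : R) (i m : ℕ) :
    ∏ j ∈ Finset.range m, (if j < i then 1 else if j = i then a else b) =
      if m ≤ i then 1 else a * b ^ (m - 1 - i) := by
  induction m with
  | zero => simp
  | succ m ih =>
    rw [Finset.prod_range_succ, ih]
    rcases lt_trichotomy m i with h | rfl | h
    · rw [if_pos h.le, if_pos h, if_pos (by omega), one_mul]
    · simp
    · rw [if_neg (by omega), if_neg (by omega), if_neg (by omega), if_neg (by omega), mul_assoc,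
        ← pow_succ]
      congr 2
      omega

theorem isUnit_iff_of_upperTriangular {m : ℕ} {A : Matrix (Fin m) (Fin m) K}
    (hA : A.BlockTriangular id) : IsUnit A ↔ ∀ i, A i i ≠ 0 := by
  rw [Matrix.isUnit_iff_isUnit_det, Matrix.det_of_isUpperTriangular hA, isUnit_iff_ne_zero,
    Finset.prod_ne_zero_iff]
  simp

theorem natCard_upperTriangular [Finite K] (m : ℕ) :
    (Nat.card {A : Matrix (Fin m) (Fin m) K // A.BlockTriangular id ∧ IsUnit A} : ℚ) =
      ∏ s ∈ Finset.range m, ((Nat.card K : ℚ) ^ (s + 1) - (Nat.card K : ℚ) ^ s) := by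
  have e : {A : Matrix (Fin m) (Fin m) K // A.BlockTriangular id ∧ IsUnit A} ≃
      ∀ i j, {x : K // (j < i → x = 0) ∧ (j = i → x ≠ 0)} :=
    { toFun := fun A i j => ⟨A.1 i j, fun h => A.2.1 h, by
        rintro rfl
        exact (isUnit_iff_of_upperTriangular A.2.1).1 A.2.2 _⟩
      invFun := fun f => ⟨fun i j => (f i j).1,
        have h : Matrix.BlockTriangular (fun i j => (f i j).1) id := fun i j hij => (f i j).2.1 hij
        ⟨h, (isUnit_iff_of_upperTriangular h).2 fun i => (f i i).2.2 rfl⟩⟩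
      left_inv := fun _ => rfl
      right_inv := fun _ => rfl }
  have hc (i j : Fin m) : (Nat.card {x : K // (j < i → x = 0) ∧ (j = i → x ≠ 0)} : ℚ) =
      if (j : ℕ) < i then 1 else if (j : ℕ) = i then (Nat.card K : ℚ) - 1 else Nat.card K := by
    rcases lt_trichotomy j i with h | rfl | h
    · rw [if_pos (by exact h)]
      have : Unique {x : K // (j < i → x = 0) ∧ (j = i → x ≠ 0)} :=
        { default := ⟨0, fun _ => rfl, fun h' => absurd h' h.ne⟩
          uniq := fun x => Subtype.ext (x.2.1 h) }
      simp
    · rw [if_neg (lt_irrefl _), if_pos rfl]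
      have e1 : {x : K // (j < j → x = 0) ∧ (j = j → x ≠ 0)} ≃ {x : K // x ≠ 0} :=
        Equiv.subtypeEquivRight (by simp)
      have e2 : Nat.card {x : K // x = 0} + Nat.card {x : K // x ≠ 0} = Nat.card K := by
        classical
        rw [← Nat.card_sum]
        exact Nat.card_congr (Equiv.sumCompl fun x : K => x = 0)
      have e3 : Nat.card {x : K // x = 0} = 1 := Nat.card_unique
      rw [Nat.card_congr e1, ← e2, e3]
      push_cast
      ring
    · rw [if_neg (by simpa using h.le), if_neg (fun h' => h.ne' (Fin.ext h'))]
      congr 1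
      refine Nat.card_congr (Equiv.subtypeUnivEquiv fun x => ⟨fun h' => absurd h' h.not_gt, fun h' =>
        absurd h' h.ne'⟩)
  -- Row i contributes (q - 1) q^(m-1-i), so the rows are reversed to match the factors q^(s+1) -
  -- q^s.
  rw [Nat.card_congr e, Nat.card_pi, Nat.cast_prod, ← Finset.prod_range_reflect,
    Finset.prod_range]
  refine Finset.prod_congr rfl fun i _ => ?_
  rw [Nat.card_pi, Nat.cast_prod, Finset.prod_congr rfl fun j _ => hc i j,
    Finset.prod_range (fun j => if j < i then 1 else
      if j = i then (Nat.card K : ℚ) - 1 else Nat.card K) |>.symm,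
    prod_range_ite_lt, if_neg (by simp)]
  ring

theorem natCard_parabolic_one [Finite K] (m : ℕ) :
    (Nat.card (parabolic (fun _ : Fin m => 1) K) : ℚ) =
      ∏ s ∈ Finset.range m, ((Nat.card K : ℚ) ^ (s + 1) - (Nat.card K : ℚ) ^ s) := by
  rw [← natCard_upperTriangular, natCard_parabolic]
  congr 1
  refine Nat.card_congr (Equiv.subtypeEquiv
    (Matrix.reindexAlgEquiv K K (oneIndexEquiv m).symm).toEquiv fun A => and_congr ?_ ?_)
  · constructor
    · intro h i j hij
      exact h hij
    · intro h x y hxy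
      obtain ⟨i, rfl⟩ := (oneIndexEquiv m).surjective x
      obtain ⟨j, rfl⟩ := (oneIndexEquiv m).surjective y
      exact h hxy
  · exact (MulEquiv.isUnit_map (Matrix.reindexAlgEquiv K K (oneIndexEquiv m).symm)).symm

variable {V : Type*} [AddCommGroup V] [Module K V]

/-- The condition that an endomorphism is upper triangular with respect to `v`. -/
def IsUpper {m : ℕ} (v : Fin m → V) (f : End K V) : Prop :=
  ∀ i, f (v i) ∈ Submodule.span K (v '' Set.Iic i)

theorem blockTriangular_iff_isUpper {m : ℕ} (b : Basis (Fin m) K V)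
    (A : Matrix (Index (fun _ : Fin m => 1)) (Index (fun _ : Fin m => 1)) K) :
    A.BlockTriangular (block (fun _ : Fin m => 1)) ↔
      IsUpper b ((LinearMap.toMatrixAlgEquiv (b.reindex (oneIndexEquiv m))).symm A) := by
  obtain ⟨f, rfl⟩ := (LinearMap.toMatrixAlgEquiv (b.reindex (oneIndexEquiv m))).surjective A
  rw [AlgEquiv.symm_apply_apply]
  have key (i j : Fin m) : LinearMap.toMatrixAlgEquiv (b.reindex (oneIndexEquiv m)) f
      (oneIndexEquiv m i) (oneIndexEquiv m j) = b.repr (f (b j)) i := by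
    rw [LinearMap.toMatrixAlgEquiv_apply]
    simp
  constructor
  · intro h j
    rw [b.mem_span_image]
    intro i hi
    by_contra hij
    have := h (i := oneIndexEquiv m i) (j := oneIndexEquiv m j) (not_le.1 hij)
    rw [key] at this
    exact Finsupp.mem_support_iff.1 hi this
  · intro h x y hxy
    obtain ⟨i, rfl⟩ := (oneIndexEquiv m).surjective x
    obtain ⟨j, rfl⟩ := (oneIndexEquiv m).surjective y
    rw [key]
    by_contra h0
    have := (b.mem_span_image.1 (h j)) (Finsupp.mem_support_iff.2 h0)
    exact absurd hxy (not_lt.2 this)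

theorem natCard_isUpper_commPairs {m : ℕ} (hm : finrank K V = m) [FiniteDimensional K V]
    {v : Fin m → V} (hv : LinearIndependent K v) :
    Nat.card {f : commPairs K V // IsUpper v f.1.1 ∧ IsUpper v f.1.2} =
      Nat.card (blockPairs (fun _ : Fin m => 1) K) := by
  let b : Basis (Fin m) K V :=
    Basis.mk hv (hv.span_eq_top_of_card_eq_finrank' (by simp [hm])).ge
  have hb : ⇑b = v := Basis.coe_mk _ _
  rw [natCard_blockPairs_eq
    (LinearMap.toMatrixAlgEquiv (b.reindex (oneIndexEquiv m))).symm.toRingEquiv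
    (blockTriangular_iff_isUpper b), hb]

theorem natCard_linearIndependent [Finite K] (m : ℕ) :
    Nat.card {v : Fin m → Fin m → K // LinearIndependent K v} = glCard K (Fin m → K) := by
  have := Fintype.ofFinite K
  rw [← Nat.card_congr (Matrix.equiv_GL_linearindependent m), glCard]
  exact Nat.card_congr (Units.mapEquiv (Matrix.toLinAlgEquiv' (R := K)
    (n := Fin m)).toMulEquiv).toEquiv

/-- Count pairs together with an adapted basis in the other order: there are |GL_m| bases, and each
is adapted to as many pairs as the standard one. -/
theorem sum_adaptedCount [Finite K] (m : ℕ) [Fintype (commPairs K (Fin m → K))] :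
    ∑ p : commPairs K (Fin m → K), adaptedCount p.1 m =
      glCard K (Fin m → K) * Nat.card (blockPairs (fun _ : Fin m => 1) K) := by
  have : Fintype {v : Fin m → Fin m → K // LinearIndependent K v} := Fintype.ofFinite _
  have : Finite (End K (Fin m → K)) := Module.finite_of_finite K
  have e : (Σ p : commPairs K (Fin m → K), {v : Fin m → Fin m → K // IsAdapted p.1 v}) ≃
      Σ v : {v : Fin m → Fin m → K // LinearIndependent K v},
        {f : commPairs K (Fin m → K) // IsUpper v.1 f.1.1 ∧ IsUpper v.1 f.1.2} :=
    { toFun := fun x => ⟨⟨x.2.1, x.2.2.1⟩, x.1, fun i => (x.2.2.2 i).1, fun i => (x.2.2.2 i).2⟩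
      invFun := fun y => ⟨y.2.1, y.1.1, y.1.2, fun i => ⟨y.2.2.1 i, y.2.2.2 i⟩⟩
      left_inv := fun _ => rfl
      right_inv := fun _ => rfl }
  have h := Nat.card_congr e
  rw [Nat.card_sigma, Nat.card_sigma, Finset.sum_congr rfl fun v _ =>
    natCard_isUpper_commPairs (by simp) (Subtype.prop v), Finset.sum_const, Finset.card_univ,
    ← Nat.card_eq_fintype_card, natCard_linearIndependent, smul_eq_mul] at h
  exact h

theorem rho_one_eq [Finite K] (m : ℕ) (a : ℕ → ℤ)
    (ha : ∀ p' ∈ commPairs K (Fin m → K), (∑ j ∈ Finset.range (m * (m - 1) / 2 + 1),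
          (a j : ℚ) * ((homCount (Fin j → K) p' : ℚ) / glCard K (Fin j → K))) *
          ∏ s ∈ Finset.range m, ((Nat.card K : ℚ) ^ (s + 1) - (Nat.card K : ℚ) ^ s) =
          adaptedCount p' m) :
    (rho (fun _ : Fin m => 1) K : ℤ) =
      ∑ j ∈ Finset.range (m * (m - 1) / 2 + 1), a j * (rho ![j, m] K : ℤ) := by
  have : Finite (End K (Fin m → K)) := Module.finite_of_finite K
  have : Fintype (commPairs K (Fin m → K)) := Fintype.ofFinite _
  have h1 : (rho (fun _ : Fin m => 1) K : ℚ) * Nat.card (parabolic (fun _ : Fin m => 1) K) =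
      Nat.card (blockPairs (fun _ : Fin m => 1) K) := by
    exact_mod_cast rho_mul_natCard_parabolic (fun _ : Fin m => 1) K
  have h2 : ∑ p : commPairs K (Fin m → K), (adaptedCount p.1 m : ℚ) =
      glCard K (Fin m → K) * Nat.card (blockPairs (fun _ : Fin m => 1) K) := by
    exact_mod_cast sum_adaptedCount (K := K) m
  have h3 : (0 : ℚ) < Nat.card (parabolic (fun _ : Fin m => 1) K) := by
    exact_mod_cast Nat.card_pos
  have h4 : (0 : ℚ) < glCard K (Fin m → K) := by exact_mod_cast glCard_pos K (Fin m → K)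
  rw [Finset.sum_congr rfl fun (p : commPairs K (Fin m → K)) _ => (ha p.1 p.2).symm,
    ← Finset.sum_mul, ← natCard_parabolic_one, ← h1, Finset.sum_comm] at h2
  have h5 : (rho (fun _ : Fin m => 1) K : ℚ) =
      ∑ j ∈ Finset.range (m * (m - 1) / 2 + 1), (a j : ℚ) * rho ![j, m] K := by
    refine mul_right_cancel₀ (mul_pos h4 h3).ne' ?_
    rw [mul_left_comm, ← h2, ← mul_assoc _ (glCard K (Fin m → K) : ℚ)]
    congr 1
    rw [Finset.sum_mul]
    refine Finset.sum_congr rfl fun j _ => ?_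
    rw [mul_assoc, rho_two_mul_glCard, Finset.mul_sum]
  exact_mod_cast h5

end UpperTriangular

end Parabolic

namespace Parabolic

open Polynomial

/-! ### Jordan blocks and the kernels of their powers -/

section JordanBlocks

variable (K : Type*) [Field K]

/-- The nilpotent Jordan block of size `k`. -/
def jordanBlock (k : ℕ) : End K (Fin k → K) where
  toFun f i := if (i : ℕ) = 0 then 0 else f ⟨i - 1, by omega⟩
  map_add' f g := by
    ext i; by_cases h : (i : ℕ) = 0 <;> simp [h]
  map_smul' c f := by
    ext i; by_cases h : (i : ℕ) = 0 <;> simp [h]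

theorem jordanBlock_pow_apply (k t : ℕ) (f : Fin k → K) (i : Fin k) :
    (jordanBlock K k ^ t) f i = if (i : ℕ) < t then 0 else f ⟨i - t, by omega⟩ := by
  induction t generalizing f i with
  | zero => simp
  | succ t ih =>
    rw [pow_succ', Module.End.mul_apply]
    change (if (i : ℕ) = 0 then 0 else (jordanBlock K k ^ t) f ⟨i - 1, by omega⟩) = _
    split_ifs with h1 h2 h2
    · rfl
    · omega
    · rw [ih, if_pos (by simp only; omega)]
    · rw [ih, if_neg (by simp only; omega)]
      congr 2
      simp only
      omega

theorem jordanBlock_pow_eq_zero_iff (k t : ℕ) (f : Fin k → K) :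
    (jordanBlock K k ^ t) f = 0 ↔ ∀ i : Fin k, (i : ℕ) + t < k → f i = 0 := by
  constructor
  · intro h i hi
    have := congrFun h ⟨i + t, hi⟩
    rw [jordanBlock_pow_apply, if_neg (by simp)] at this
    simpa using this
  · intro h
    ext i
    rw [jordanBlock_pow_apply]
    split_ifs with h1
    · rfl
    · exact h _ (by simp only; omega)

variable {K} in
/-- The quotient of `K[X]` by `X ^ k` is a Jordan block. -/
theorem exists_equiv_jordanBlock (k : ℕ) :
    ∃ e : (K[X] ⧸ (K[X] ∙ (X : K[X]) ^ k)) ≃ₗ[K] (Fin k → K),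
      ∀ a, e ((X : K[X]) • a) = jordanBlock K k (e a) := by
  let c : K[X] →ₗ[K] (Fin k → K) := LinearMap.pi fun i => lcoeff K i
  have hc : c.ker = (K[X] ∙ (X : K[X]) ^ k).restrictScalars K := by
    ext p
    rw [LinearMap.mem_ker, Submodule.restrictScalars_mem, Submodule.mem_span_singleton]
    have : (∃ a : K[X], a • (X : K[X]) ^ k = p) ↔ X ^ k ∣ p :=
      ⟨fun ⟨a, h⟩ => ⟨a, by rw [← h, smul_eq_mul, mul_comm]⟩,
        fun ⟨a, h⟩ => ⟨a, by rw [h, smul_eq_mul, mul_comm]⟩⟩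
    rw [this, X_pow_dvd_iff]
    constructor
    · intro h d hd
      exact congrFun h ⟨d, hd⟩
    · intro h
      exact funext fun i => h i i.2
  have hs : Function.Surjective c := by
    intro f
    refine ⟨∑ i : Fin k, monomial (i : ℕ) (f i), ?_⟩
    ext i
    simp only [c, LinearMap.pi_apply, lcoeff_apply, finsetSum_coeff, coeff_monomial]
    rw [Finset.sum_eq_single i]
    · simp
    · intro j _ hj
      rw [if_neg (fun h => hj (Fin.ext h))]
    · simp
  let e : (K[X] ⧸ (K[X] ∙ (X : K[X]) ^ k)) ≃ₗ[K] (Fin k → K) :=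
    (Submodule.Quotient.restrictScalarsEquiv K (K[X] ∙ (X : K[X]) ^ k)).symm ≪≫ₗ
      Submodule.quotEquivOfEq _ _ hc.symm ≪≫ₗ c.quotKerEquivOfSurjective hs
  have he (p : K[X]) : e (Submodule.Quotient.mk p) = c p := rfl
  refine ⟨e, fun a => ?_⟩
  obtain ⟨p, rfl⟩ := Submodule.Quotient.mk_surjective _ a
  rw [← Submodule.Quotient.mk_smul, he, he]
  ext i
  change coeff (X * p) i = if (i : ℕ) = 0 then 0 else coeff p (i - 1)
  split_ifs with h
  · rw [h]; simp
  · obtain ⟨j, hj⟩ := Nat.exists_eq_succ_of_ne_zero h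
    rw [hj, coeff_X_mul]; rfl

/-- The nilpotent endomorphism with Jordan blocks of sizes `k`. -/
def jordan {ι : Type*} (k : ι → ℕ) : End K (∀ i, Fin (k i) → K) :=
  LinearMap.pi fun i => jordanBlock K (k i) ∘ₗ LinearMap.proj i

theorem jordan_pow_apply {ι : Type*} (k : ι → ℕ) (t : ℕ) (F : ∀ i, Fin (k i) → K) (i : ι) :
    (jordan K k ^ t) F i = (jordanBlock K (k i) ^ t) (F i) := by
  induction t generalizing F with
  | zero => rfl
  | succ t ih => rw [pow_succ, pow_succ, Module.End.mul_apply, ih]; rfl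

theorem isNilpotent_jordan {ι : Type*} [Finite ι] (k : ι → ℕ) : IsNilpotent (jordan K k) := by
  cases nonempty_fintype ι
  refine ⟨∑ i, k i, LinearMap.ext fun F => funext fun i => ?_⟩
  rw [jordan_pow_apply]
  refine (jordanBlock_pow_eq_zero_iff K _ _ _).2 fun j hj => ?_
  have := Finset.single_le_sum (fun i _ => Nat.zero_le (k i)) (Finset.mem_univ i)
  omega

theorem prod_range_ite_add_lt (q k t : ℕ) :
    ∏ a ∈ Finset.range k, (if a + t < k then 1 else q) = q ^ min t k := by
  rw [← Finset.prod_range_reflect]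
  have : ∀ n ≤ k, ∏ a ∈ Finset.range n, (if k - 1 - a + t < k then 1 else q) = q ^ min t n := by
    intro n
    induction n with
    | zero => simp
    | succ n ih =>
      intro hn
      rw [Finset.prod_range_succ, ih (by omega)]
      split_ifs with h
      · rw [min_eq_left (by omega), min_eq_left (by omega), mul_one]
      · rw [min_eq_right (by omega), min_eq_right (by omega), pow_succ]
  exact this k le_rfl

theorem finrank_pi_fin {ι : Type*} [Fintype ι] (k : ι → ℕ) :
    finrank K (∀ i, Fin (k i) → K) = ∑ i, k i := by
  rw [finrank_pi_fintype]
  simp only [finrank_fin_fun]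

/-- The kernel is cut out by the vanishing of coordinates, leaving min(t, k i) free in block i.
Counting its elements gives a power of q whose exponent is the dimension. -/
theorem finrank_ker_jordan_pow [Finite K] {ι : Type*} [Fintype ι] (k : ι → ℕ) (t : ℕ) :
    finrank K (jordan K k ^ t).ker = ∑ i, min t (k i) := by
  have e : (jordan K k ^ t).ker ≃ ∀ i, ∀ a : Fin (k i), {x : K // (a : ℕ) + t < k i → x = 0} :=
    { toFun := fun F i a => ⟨F.1 i a, (jordanBlock_pow_eq_zero_iff K _ _ _).1
        ((jordan_pow_apply K k t F.1 i).symm.trans (congrFun F.2 i)) a⟩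
      invFun := fun G => ⟨fun i a => (G i a).1, funext fun i =>
        (jordan_pow_apply K k t _ i).trans
          ((jordanBlock_pow_eq_zero_iff K _ _ _).2 fun a => (G i a).2)⟩
      left_inv := fun _ => rfl
      right_inv := fun _ => rfl }
  have h := Nat.card_congr e
  have hc (i : ι) (a : Fin (k i)) : Nat.card {x : K // (a : ℕ) + t < k i → x = 0} =
      if (a : ℕ) + t < k i then 1 else Nat.card K := by
    split_ifs with h
    · rw [Nat.card_congr (Equiv.subtypeEquivRight (q := fun x => x = 0) (by simp [h]))]
      exact Nat.card_unique
    · exact Nat.card_congr (Equiv.subtypeUnivEquiv fun x => fun h' => absurd h' h)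
  rw [Nat.card_pi, Module.natCard_eq_pow_finrank (K := K)] at h
  refine Nat.pow_right_injective Finite.one_lt_card (h.trans ?_)
  simp only
  rw [← Finset.prod_pow_eq_pow_sum]
  refine Finset.prod_congr rfl fun i _ => ?_
  rw [Nat.card_pi, Finset.prod_congr rfl fun a _ => hc i a,
    ← Finset.prod_range fun a => if a + t < k i then 1 else Nat.card K, prod_range_ite_add_lt]

end JordanBlocks

/-! ### Classification of nilpotent endomorphisms -/

section JordanForm

variable {K : Type*} [Field K] {V V' : Type*} [AddCommGroup V] [Module K V] [AddCommGroup V']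
  [Module K V']

theorem exists_equiv_jordan [FiniteDimensional K V] {x : End K V} (hx : IsNilpotent x) :
    ∃ (ι : Type) (_ : Fintype ι) (k : ι → ℕ) (e : V ≃ₗ[K] (∀ i, Fin (k i) → K)),
      (∀ i, 0 < k i) ∧ ∀ v, e (x v) = jordan K k (e v) := by
  have htors : IsTorsion' (AEval' x) (Submonoid.powers (X : K[X])) := by
    obtain ⟨n, hn⟩ := hx
    intro v
    refine ⟨⟨X ^ n, n, rfl⟩, ?_⟩
    obtain ⟨v, rfl⟩ := (AEval'.of x).surjective v
    change (X : K[X]) ^ n • AEval'.of x v = 0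
    rw [AEval'.X_pow_smul_of, hn]
    simp
  obtain ⟨d, k, ⟨φ⟩⟩ :=
    torsion_by_prime_power_decomposition (Polynomial.irreducible_X (R := K)) htors
  choose E hE using fun i : Fin d => exists_equiv_jordanBlock (K := K) (k i)
  let φ₁ : AEval' x ≃ₗ[K[X]] (∀ i : Fin d, K[X] ⧸ (K[X] ∙ (X : K[X]) ^ k i)) :=
    φ ≪≫ₗ DirectSum.linearEquivFunOnFintype K[X] (Fin d) _
  let ψ : V ≃ₗ[K] (∀ i : Fin d, Fin (k i) → K) :=
    AEval'.of x ≪≫ₗ φ₁.restrictScalars K ≪≫ₗ LinearEquiv.piCongrRight E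
  have hψ (v : V) (i : Fin d) : ψ (x v) i = jordanBlock K (k i) (ψ v i) := by
    change E i (φ₁ (AEval'.of x (x v)) i) = jordanBlock K (k i) (E i (φ₁ (AEval'.of x v) i))
    rw [← AEval'.X_smul_of, map_smul, ← hE]
    rfl
  -- Blocks of size zero are discarded: kernel dimensions cannot detect them.
  have hr : Function.Bijective (fun (F : ∀ i, Fin (k i) → K) (i : {i // 0 < k i}) => F i.1) := by
    constructor
    · intro F G h
      ext i a
      exact congrFun (congrFun h ⟨i, a.pos⟩) a
    · intro F
      refine ⟨fun i => if h : 0 < k i then F ⟨i, h⟩ else 0, ?_⟩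
      ext i a
      simp [i.2]
  let r : (∀ i, Fin (k i) → K) ≃ₗ[K] (∀ i : {i // 0 < k i}, Fin (k i.1) → K) :=
    LinearEquiv.ofBijective (LinearMap.pi fun i : {i // 0 < k i} => LinearMap.proj i.1) hr
  refine ⟨{i // 0 < k i}, inferInstance, fun i => k i.1, ψ ≪≫ₗ r, fun i => i.2, fun v => ?_⟩
  ext1 i
  exact hψ v i.1

theorem finrank_ker_pow_congr (e : V ≃ₗ[K] V') {x : End K V} {y : End K V'}
    (h : ∀ v, e (x v) = y (e v)) (t : ℕ) : finrank K (x ^ t).ker = finrank K (y ^ t).ker := by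
  have hp (v : V) : e ((x ^ t) v) = (y ^ t) (e v) := by
    induction t generalizing v with
    | zero => rfl
    | succ t ih => rw [pow_succ, pow_succ, Module.End.mul_apply, Module.End.mul_apply, ih, h]
  have : (x ^ t).ker = (y ^ t).ker.comap e.toLinearMap := by
    ext v
    rw [Submodule.mem_comap, LinearMap.mem_ker, LinearMap.mem_ker, LinearEquiv.coe_coe, ← hp,
      map_eq_zero_iff e e.injective]
  rw [this]
  exact LinearEquiv.finrank_eq (LinearEquiv.ofSubmodule' e _)

theorem card_lt_of_sum_min {ι : Type*} [Fintype ι] (k : ι → ℕ) (t : ℕ) :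
    ∑ i, min t (k i) + Fintype.card {i // t < k i} = ∑ i, min (t + 1) (k i) := by
  rw [Fintype.card_subtype, Finset.card_filter, ← Finset.sum_add_distrib]
  refine Finset.sum_congr rfl fun i _ => ?_
  split_ifs <;> omega

theorem card_eq_succ_add_card_lt {ι : Type*} [Fintype ι] (f : ι → ℕ) (t : ℕ) :
    Fintype.card {i // f i = t + 1} + Fintype.card {i // t + 1 < f i} =
      Fintype.card {i // t < f i} := by
  rw [Fintype.card_subtype, Fintype.card_subtype, Fintype.card_subtype, Finset.card_filter,
    Finset.card_filter, Finset.card_filter, ← Finset.sum_add_distrib]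
  refine Finset.sum_congr rfl fun i _ => ?_
  split_ifs <;> omega

/-- First differences in t count the parts exceeding t, and differences of these count the parts
equal to t + 1. Positivity rules out parts equal to 0, which the sums do not see. -/
theorem exists_equiv_of_sum_min_eq {ι ι' : Type*} [Fintype ι] [Fintype ι'] {k : ι → ℕ}
    {k' : ι' → ℕ} (hk : ∀ i, 0 < k i) (hk' : ∀ i, 0 < k' i)
    (h : ∀ t, ∑ i, min t (k i) = ∑ i, min t (k' i)) : ∃ σ : ι ≃ ι', ∀ i, k' (σ i) = k i := by
  have hlt (t : ℕ) : Fintype.card {i // t < k i} = Fintype.card {i // t < k' i} := by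
    have h1 := card_lt_of_sum_min k t
    have h2 := card_lt_of_sum_min k' t
    rw [← h, ← h] at h2
    omega
  have heq (t : ℕ) : Nonempty ({i // k i = t} ≃ {i // k' i = t}) := by
    obtain _ | t := t
    · have h1 : IsEmpty {i // k i = 0} := ⟨fun i => (hk i.1).ne' i.2⟩
      have h2 : IsEmpty {i // k' i = 0} := ⟨fun i => (hk' i.1).ne' i.2⟩
      exact ⟨Equiv.equivOfIsEmpty _ _⟩
    · refine Fintype.card_eq.1 ?_
      have h1 := card_eq_succ_add_card_lt k t
      have h2 := card_eq_succ_add_card_lt k' t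
      rw [← hlt, ← hlt] at h2
      omega
  exact ⟨Equiv.ofFiberEquiv fun t => (heq t).some, fun i => Equiv.ofFiberEquiv_map _ _⟩

theorem exists_conj_of_finrank_ker_pow_eq [Finite K] [FiniteDimensional K V]
    [FiniteDimensional K V'] {x : End K V} {y : End K V'} (hx : IsNilpotent x)
    (hy : IsNilpotent y) (h : ∀ t, finrank K (x ^ t).ker = finrank K (y ^ t).ker) :
    ∃ e : V ≃ₗ[K] V', ∀ v, e (x v) = y (e v) := by
  obtain ⟨ι, _, k, e, hk, he⟩ := exists_equiv_jordan hx
  obtain ⟨ι', _, k', e', hk', he'⟩ := exists_equiv_jordan hy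
  obtain ⟨σ, hσ⟩ := exists_equiv_of_sum_min_eq hk hk' fun t => by
    rw [← finrank_ker_jordan_pow K k, ← finrank_ker_jordan_pow K k', ← finrank_ker_pow_congr e he,
      ← finrank_ker_pow_congr e' he', h]
  obtain rfl : k = fun i => k' (σ i) := funext fun i => (hσ i).symm
  let ρ : (∀ i, Fin (k' (σ i)) → K) ≃ₗ[K] (∀ i, Fin (k' i) → K) :=
    LinearEquiv.piCongrLeft K (fun i => Fin (k' i) → K) σ
  have hρ (F : ∀ i, Fin (k' (σ i)) → K) (i : ι) : ρ F (σ i) = F i :=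
    Equiv.piCongrLeft_apply_apply (fun i => Fin (k' i) → K) σ F i
  refine ⟨e ≪≫ₗ ρ ≪≫ₗ e'.symm, fun v => e'.injective ?_⟩
  rw [he']
  simp only [LinearEquiv.trans_apply, LinearEquiv.apply_symm_apply, he]
  ext1 i
  obtain ⟨i, rfl⟩ := σ.surjective i
  rw [hρ]
  change jordanBlock K _ (e v i) = jordanBlock K _ (ρ (e v) (σ i))
  rw [hρ]

end JordanForm

/-! ### Nilpotent classes and independence of the field -/

section NilpotentClasses

/-- The sequences `t ↦ ∑ min (t, kᵢ)` attached to the partitions `k` of `j`. -/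
def kerSequences (j : ℕ) : Set (ℕ → ℕ) :=
  {c | ∃ (ι : Type) (_ : Fintype ι) (k : ι → ℕ), ∑ i, k i = j ∧ c = fun t => ∑ i, min t (k i)}

variable {K : Type u} [Field K]

/-- With one block the triangularity condition is empty. The dimensions of the kernels of powers are
a complete conjugacy invariant, and their possible values do not involve K. -/
theorem rho_single_eq [Finite K] (j : ℕ) :
    rho (fun _ : Fin 1 => j) K = Nat.card (kerSequences j) := by
  let l : Fin 1 → ℕ := fun _ => j
  let V := Index l → K
  have hV : finrank K V = j := by simp [V, l]
  have htri (A : Matrix (Index l) (Index l) K) : A.BlockTriangular (block l) :=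
    fun a b h => absurd h (by simp [Subsingleton.elim (block l a) (block l b)])
  let Ψ : Matrix (Index l) (Index l) K ≃ₐ[K] End K V := Matrix.toLinAlgEquiv'
  let c (x : nilpotents l K) : ℕ → ℕ := fun t => finrank K (Ψ x.1 ^ t).ker
  have hc (x y : nilpotents l K) : MulAction.orbitRel (parabolic l K) (nilpotents l K) x y ↔
      c x = c y := by
    rw [MulAction.orbitRel_apply, MulAction.mem_orbit_iff]
    constructor
    · rintro ⟨g, rfl⟩
      funext t
      have hg : IsUnit (Ψ g.1.1) := g.1.isUnit.map Ψ
      refine (finrank_ker_pow_congr (LinearEquiv.ofBijective _ ((Module.End.isUnit_iff _).1 hg))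
        (fun v => ?_) t).symm
      have : g.1.1 * y.1 = (g.1.1 * y.1 * (g⁻¹).1.1) * g.1.1 := by
        rw [mul_assoc]
        change _ = _ * ((g.1⁻¹).1 * g.1.1)
        rw [Units.inv_mul, mul_one]
      have := congrArg Ψ this
      rw [map_mul, map_mul] at this
      exact LinearMap.congr_fun this v
    · intro h
      obtain ⟨e, he⟩ := exists_conj_of_finrank_ker_pow_eq (y.2.2.map Ψ) (x.2.2.map Ψ)
        fun t => (congrFun h t).symm
      have hu : IsUnit (Ψ.symm e.toLinearMap) :=
        ((Module.End.isUnit_iff _).2 e.bijective).map Ψ.symm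
      refine ⟨⟨hu.unit, htri _⟩, Subtype.ext ?_⟩
      change hu.unit.1 * y.1 * (hu.unit⁻¹).1 = x.1
      rw [Units.mul_inv_eq_iff_eq_mul, IsUnit.unit_spec]
      apply Ψ.injective
      rw [map_mul, map_mul, AlgEquiv.apply_symm_apply]
      exact LinearMap.ext he
  have hrange : Set.range c = kerSequences j := by
    ext f
    constructor
    · rintro ⟨x, rfl⟩
      obtain ⟨ι, _, k, e, -, he⟩ := exists_equiv_jordan (x.2.2.map Ψ)
      refine ⟨ι, inferInstance, k, ?_, funext fun t => ?_⟩
      · rw [← hV, e.finrank_eq, finrank_pi_fin]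
      · rw [← finrank_ker_jordan_pow K k]
        exact finrank_ker_pow_congr e he t
    · rintro ⟨ι, _, k, hk, rfl⟩
      let e : (∀ i, Fin (k i) → K) ≃ₗ[K] V :=
        LinearEquiv.ofFinrankEq _ _ (by rw [hV, finrank_pi_fin, hk])
      have hn : IsNilpotent (Ψ.symm (e.conjRingEquiv (jordan K k))) :=
        ((isNilpotent_jordan K k).map e.conjRingEquiv).map Ψ.symm
      refine ⟨⟨_, htri _, hn⟩, funext fun t => ?_⟩
      rw [← finrank_ker_jordan_pow K k]
      simp only [c]
      rw [AlgEquiv.apply_symm_apply]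
      exact (finrank_ker_pow_congr e (fun v => by simp) t).symm
  rw [rho, ← hrange]
  refine Nat.card_congr ((Quotient.congrRight fun x y => ?_).trans (Setoid.quotientKerEquivRange c))
  rw [Setoid.ker_def]
  exact hc x y

/-- Burnside's lemma for a single block. It makes the coefficients of the series P integers
independent of K. -/
theorem natCard_commPairs [Finite K] (j : ℕ) :
    Nat.card (commPairs K (Fin j → K)) = Nat.card (kerSequences j) * glCard K (Fin j → K) := by
  let l : Fin 1 → ℕ := fun _ => j
  have htri (A : Matrix (Index l) (Index l) K) : A.BlockTriangular (block l) :=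
    fun a b h => absurd h (by simp [Subsingleton.elim (block l a) (block l b)])
  let b : Basis (Index l) K (Fin j → K) :=
    (Pi.basisFun K (Fin j)).reindex (Equiv.uniqueSigma (fun i : Fin 1 => Fin (l i))).symm
  let Ψ : Matrix (Index l) (Index l) K ≃+* End K (Fin j → K) :=
    (LinearMap.toMatrixAlgEquiv b).symm.toRingEquiv
  have h := rho_mul_natCard_parabolic l K
  rw [natCard_parabolic_eq (P := fun _ => True) Ψ fun A => iff_of_true (htri A) trivial,
    natCard_blockPairs_eq (P := fun _ => True) Ψ fun A => iff_of_true (htri A) trivial,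
    rho_single_eq] at h
  have h1 : Nat.card {f : commPairs K (Fin j → K) // True ∧ True} =
      Nat.card (commPairs K (Fin j → K)) :=
    Nat.card_congr (Equiv.subtypeUnivEquiv fun _ => ⟨trivial, trivial⟩)
  rw [h1] at h
  rw [← h, glCard]
  congr 1
  symm
  refine Nat.card_congr (Equiv.ofBijective (fun u => ⟨u.1, trivial, u.isUnit⟩) ⟨?_, ?_⟩)
  · intro u u' H
    exact Units.ext (congrArg Subtype.val H)
  · rintro ⟨f, -, ⟨u, rfl⟩⟩
    exact ⟨u, rfl⟩

theorem natCard_kerSequences_zero : Nat.card (kerSequences 0) = 1 := by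
  have : Unique (kerSequences 0) :=
    { default := ⟨fun _ => 0, Empty, inferInstance, fun i => i.elim, by simp, by simp⟩
      uniq := by
        rintro ⟨f, ι, _, k, hk, rfl⟩
        refine Subtype.ext (funext fun t => ?_)
        refine Finset.sum_eq_zero fun i hi => ?_
        rw [Finset.sum_eq_zero_iff.1 hk i hi, Nat.min_zero] }
  exact Nat.card_unique

/-- For j = 0 every normalised homomorphism count is 1. This is the term of (i) that the hypothesis
of (ii), stated for positive k, does not cover. -/
theorem rho_zero_eq [Finite K] (m : ℕ) : rho ![0, m] K = Nat.card (kerSequences m) := by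
  have : Finite (End K (Fin m → K)) := Module.finite_of_finite K
  have : Fintype (commPairs K (Fin m → K)) := Fintype.ofFinite _
  have h := rho_two_mul_glCard K 0 m
  have h0 (p' : commPairs K (Fin m → K)) :
      (homCount (Fin 0 → K) p'.1 : ℚ) / glCard K (Fin 0 → K) = 1 := by
    have e1 : homCount (Fin 0 → K) p'.1 = Nat.card (commPairs K (Fin 0 → K)) := by
      refine Nat.card_congr ⟨fun x => x.1, fun p => ⟨p, 0⟩, fun x => ?_, fun _ => rfl⟩
      have : x.2 = 0 := Subtype.ext (LinearMap.ext fun v => by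
        rw [Subsingleton.elim v 0, map_zero, map_zero])
      exact Sigma.ext rfl (heq_of_eq this.symm)
    have := glCard_pos K (Fin 0 → K)
    rw [e1, natCard_commPairs, natCard_kerSequences_zero, one_mul, div_self (by positivity)]
  rw [Finset.sum_congr rfl fun p' _ => h0 p', Finset.sum_const, Finset.card_univ, nsmul_one,
    ← Nat.card_eq_fintype_card, natCard_commPairs, Nat.cast_mul] at h
  have hg : (glCard K (Fin m → K) : ℚ) ≠ 0 := by
    have := glCard_pos K (Fin m → K)
    positivity
  exact_mod_cast mul_right_cancel₀ hg h

end NilpotentClasses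

end Parabolic

/-! ### The two parts of the theorem -/

theorem mainTheorem3 :
    (∀ m : ℕ, 0 < m → ∃ a : ℕ → ℤ, ∀ (K : Type u) [Field K] [Finite K],
      (Parabolic.rho (fun _ : Fin m => 1) K : ℤ) =
        ∑ j ∈ Finset.range (m * (m - 1) / 2 + 1), a j * (Parabolic.rho ![j, m] K : ℤ)) ∧
    (Parabolic.MaximalParabolicConjecture.{u} → Parabolic.UnitriangularConjecture.{u}) := by
  have main : ∀ m : ℕ, ∃ a : ℕ → ℤ, ∀ (K : Type u) [Field K] [Finite K],
      (Parabolic.rho (fun _ : Fin m => 1) K : ℤ) =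
        ∑ j ∈ Finset.range (m * (m - 1) / 2 + 1), a j * (Parabolic.rho ![j, m] K : ℤ) := by
    intro m
    obtain ⟨a, ha⟩ := Parabolic.exists_coefficients
      (fun j => (Nat.card (Parabolic.kerSequences j) : ℤ))
      (by rw [Parabolic.natCard_kerSequences_zero]; rfl) m
    refine ⟨a, fun K _ _ => Parabolic.rho_one_eq m a fun p' hp' => ?_⟩
    exact ha (fun j => by rw [Parabolic.natCard_commPairs]; push_cast; rfl) (Fin m → K) p' hp'
      (by simp)
  refine ⟨fun m _ => main m, fun hmax m hm => ?_⟩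
  obtain ⟨a, ha⟩ := main m
  have hpoly (j : ℕ) : Parabolic.RhoIsPolynomial.{u} ![j, m] := by
    obtain rfl | hj := j.eq_zero_or_pos
    · exact ⟨Polynomial.C (Nat.card (Parabolic.kerSequences m) : ℚ), fun K _ _ => by
        rw [Parabolic.rho_zero_eq, Polynomial.eval_C]⟩
    · exact hmax j m hj hm
  choose g hg using hpoly
  refine ⟨∑ j ∈ Finset.range (m * (m - 1) / 2 + 1), Polynomial.C (a j : ℚ) * g j, fun K _ _ => ?_⟩
  have h := congrArg (Int.cast : ℤ → ℚ) (ha K)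
  push_cast at h
  rw [h, Polynomial.eval_finsetSum]
  refine Finset.sum_congr rfl fun j _ => ?_
  rw [Polynomial.eval_mul, Polynomial.eval_C, hg]
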